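/- Let $N\ge 11$ be an integer and let $f\in C^2(\mathbb R\setminus\{0\})\cap C^1(\mathbb R)$ be odd, with $f(u)>0$, $f'(u)>0$, $f''(u)>0$ and $F(u):=\int_u^\infty \frac{ds}{f(s)}<\infty$ for all $u>0$. Put $q_{JL}=\frac{N-2\sqrt{N-1}}{4}$. Assume that the finite limits $q_0=\lim_{u\to 0^+}f'(u)F(u)$ and $q_\infty=\lim_{u\to\infty}f'(u)F(u)$ exist and satisfy $1<q_0<q_{JL}<q_\infty$. For $\alpha>0$ let $u(\cdot,\alpha)\in C^2[0,\infty)$ be the unique solution of $$u''+\frac{N-1}{r}u'+f(u)=0\quad (r>0),\qquad u(0)=\alpha,\quad u'(0)=0$$ (this solution exists on all of $[0,\infty)$ and is unique). Call $u(\cdot,\alpha)$ stable if $$\int_{\mathbb R^N}\left(|\nabla\phi(x)|^2-f'(u(|x|,\alpha))\,\phi(x)^2\right)dx\ge 0\quad\text{for every compactly supported } \phi\in C^1(\mathbb R^N),$$ and unstable otherwise. Then there exists $\alpha^*\in(0,\infty)$ such that $u(\cdot,\alpha)$ is stable for every $\alpha\in(0,\alpha^*]$ and unstable for every $\alpha>\alpha^*$;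 moreover, for each fixed $r>0$, $u(r,\alpha)$ is strictly increasing in $\alpha\in(0,\alpha^*)$. -/

import Mathlib

open Set Filter Topology MeasureTheory

noncomputable section

namespace RadialStability

/-- `F(u) = ∫_u^∞ ds / f(s)`, used for `u > 0`. -/
def tailIntegral (f : ℝ → ℝ) (u : ℝ) : ℝ := ∫ s in Ioi u, 1 / f s

/-- The standing assumptions on the nonlinearity: `f ∈ C²(ℝ ∖ {0}) ∩ C¹(ℝ)` is odd, and
`f, f', f'' > 0` and `F(u) < ∞` for `u > 0`. -/
structure IsAdmissible (f : ℝ → ℝ) : Prop where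
  contDiff : ContDiff ℝ 1 f
  contDiffOn : ContDiffOn ℝ 2 f {0}ᶜ
  odd : ∀ u, f (-u) = -f u
  pos : ∀ u > 0, 0 < f u
  deriv_pos : ∀ u > 0, 0 < deriv f u
  deriv_deriv_pos : ∀ u > 0, 0 < deriv (deriv f) u
  tail_finite : ∀ u > 0, IntegrableOn (fun s => 1 / f s) (Ioi u)

/-- The exponent `q_JL = (N - 2 √(N - 1)) / 4`. -/
def qJL (N : ℕ) : ℝ := ((N : ℝ) - 2 * √((N : ℝ) - 1)) / 4

/-- `u ∈ C²[0, ∞)` solves `u'' + (N - 1) / r * u' + f(u) = 0` for `r > 0`, with `u(0) = α` and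
`u'(0) = 0`. Only the values of `u` on `[0, ∞)` matter. -/
structure IsRadialSolution (N : ℕ) (f : ℝ → ℝ) (α : ℝ) (u : ℝ → ℝ) : Prop where
  contDiffOn : ContDiffOn ℝ 2 u (Ici 0)
  ode : ∀ r > 0, deriv (deriv u) r + ((N : ℝ) - 1) / r * deriv u r + f (u r) = 0
  init : u 0 = α
  deriv_init : derivWithin u (Ici 0) 0 = 0

/-- Stability of an entire solution `U` of `Δ U + f(U) = 0` in `ℝ^N`:
`∫ (|∇ φ|² - f'(U) φ²) dx ≥ 0` for every `φ ∈ C¹` with compact support.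
A solution that is not stable is called unstable. -/
def IsStable {N : ℕ} (f : ℝ → ℝ) (U : EuclideanSpace ℝ (Fin N) → ℝ) : Prop :=
  ∀ φ : EuclideanSpace ℝ (Fin N) → ℝ, ContDiff ℝ 1 φ → HasCompactSupport φ →
    0 ≤ ∫ x, (‖gradient φ x‖ ^ 2 - deriv f (U x) * φ x ^ 2)

/-- The radial function `x ↦ u(|x|)` on `ℝ^N`. -/
def radial (N : ℕ) (u : ℝ → ℝ) : EuclideanSpace ℝ (Fin N) → ℝ := fun x => u ‖x‖

/-- Structure (III) for a family `u α`, `α > 0`, of radial profiles: there is `αs ∈ (0, ∞)` such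
that `u α` is stable for `α ∈ (0, αs]` and unstable for `α > αs`; moreover, for each fixed `r > 0`,
`u α r` is strictly increasing in `α ∈ (0, αs)`. -/
def StructureIII (N : ℕ) (f : ℝ → ℝ) (u : ℝ → ℝ → ℝ) : Prop :=
  ∃ αs > 0,
    (∀ α ∈ Ioc 0 αs, IsStable f (radial N (u α))) ∧
    (∀ α > αs, ¬ IsStable f (radial N (u α))) ∧
    (∀ r > 0, StrictMonoOn (fun α => u α r) (Ioo 0 αs))

end RadialStability

end

/-! Call an initial value stable if its solution is. The stable initial values form an interval. If
`u = u(·,α)` is stable and `v` starts lower, then testing the stability inequality with `u - v` up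
to its first zero contradicts the strict convexity of `f`, so `v < u` as long as `v > 0`. A
Wronskian argument, using that `f(s)/s` increases, excludes a zero of `v`. Hence `0 < v < u`, so
`f'(v) ≤ f'(u)` and `v` is stable too (`IsProfile.isStable_of_lt`). Continuous dependence on `α`
shows that the supremum of the interval is itself stable (`isStable_of_forall_lt`). It remains to
show that the interval is neither empty nor all of `(0,∞)`.

Both facts use `V = F(u)`, which satisfies `V'' + (N-1)V'/r = 1 + f'(u)V'²`. Here `f'(u) = Q/V` with
`Q = f'F` evaluated along `u`, and `Q` is close to `q₀` for small values of `u` and to `q_∞` for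
large ones. For constant `Q = q` there is the singular solution `V = r²/(2N-4q)`, with potential
`q(2N-4q)/r²`. When `q < N/4`, this lies below the Hardy potential `(N-2)²/(4r²)` exactly when `q <
q_JL`.

Small `α`: `u` cannot cross the singular profile (`IsProfile.sq_lt_mul_tail`), so `r² f'(u)` stays
below the Hardy constant and the solution is stable (`exists_forall_le_isStable`).

Large `α`: suppose every solution is stable. Testing stability with `V^(-a) η` and using the
equation for `V` (`IsProfile.weighted_estimate`) bounds `∫ r^(N-1) V^(-2a-1) η²` independently of
`α`. The method allows any `a` with `q_∞ < a < q_∞ + √q_∞`. Since `q_∞ > q_JL`, some such `a`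
exceeds `(N-2)/4`, and then the ball of radius about `√F(α)`, on which `V ≤ 2F(α)`, contributes a
multiple of `F(α)^(N/2-2a-1) → ∞`. This is a contradiction (`exists_not_isStable`). -/

namespace RadialStability

/-! ### Real analysis -/

/-- A continuous function that starts positive and is nonpositive somewhere has a first zero. -/
lemma exists_first_zero {d : ℝ → ℝ} {a b : ℝ} (hab : a ≤ b) (hd : ContinuousOn d (Icc a b))
    (ha : 0 < d a) (hb : d b ≤ 0) :
    ∃ c, a < c ∧ c ≤ b ∧ d c = 0 ∧ ∀ r ∈ Ico a c, 0 < d r := by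
  set S := Icc a b ∩ d ⁻¹' Iic 0 with hS
  have hScl : IsClosed S := hd.preimage_isClosed_of_isClosed isClosed_Icc isClosed_Iic
  have hSne : S.Nonempty := ⟨b, ⟨hab, le_rfl⟩, hb⟩
  have hSbdd : BddBelow S := ⟨a, fun x hx => hx.1.1⟩
  have hc := hScl.csInf_mem hSne hSbdd
  set c := sInf S
  have hlt : ∀ r ∈ Ico a c, 0 < d r := by
    intro r hr
    by_contra! h
    have : c ≤ r := csInf_le hSbdd ⟨⟨hr.1, hr.2.le.trans hc.1.2⟩, h⟩
    exact absurd hr.2 (not_lt.2 this)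
  have hac : a < c := by
    refine lt_of_le_of_ne hc.1.1 fun h => ?_
    have := hc.2
    rw [← h] at this
    exact absurd ha (not_lt.2 this)
  refine ⟨c, hac, hc.1.2, le_antisymm hc.2 ?_, hlt⟩
  have hcont : ContinuousWithinAt d (Ico a c) c :=
    (hd c hc.1).mono fun x hx => ⟨hx.1, hx.2.le.trans hc.1.2⟩
  have : (𝓝[Ico a c] c).NeBot := by
    rw [← mem_closure_iff_nhdsWithin_neBot, closure_Ico hac.ne]
    exact ⟨hac.le, le_rfl⟩
  exact ge_of_tendsto hcont (eventually_mem_nhdsWithin.mono fun x hx => (hlt x hx).le)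

/-- The left derivative is nonpositive at the first zero of a positive function. -/
lemma deriv_nonpos_of_first_zero {d : ℝ → ℝ} {d' a c : ℝ} (hac : a < c) (h : HasDerivAt d d' c)
    (hc : d c = 0) (hpos : ∀ r ∈ Ioo a c, 0 < d r) : d' ≤ 0 := by
  have h1 := (hasDerivAt_iff_tendsto_slope_left_right.1 h).1
  refine le_of_tendsto h1 ?_
  filter_upwards [Ioo_mem_nhdsLT hac] with r hr
  rw [slope_def_field, hc]
  exact div_nonpos_of_nonneg_of_nonpos (by simpa using (hpos r hr).le) (by linarith [hr.2])

/-- Fundamental theorem of calculus for functions differentiable inside an interval. -/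
lemma integral_eq_sub_of_hasDerivAt_Ioo {g g' : ℝ → ℝ} {R : ℝ} (hR : 0 ≤ R)
    (hg : ContinuousOn g (Icc 0 R)) (hd : ∀ r ∈ Ioo 0 R, HasDerivAt g (g' r) r)
    (hg' : ContinuousOn g' (Icc 0 R)) : ∫ r in 0..R, g' r = g R - g 0 :=
  intervalIntegral.integral_eq_sub_of_hasDerivAt_of_le hR hg hd
    (hg'.intervalIntegrable_of_Icc hR)

/-- Strict monotonicity of integrals of continuous functions. -/
lemma integral_lt_integral_Icc {g h : ℝ → ℝ} {R : ℝ} (hR : 0 < R)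
    (hg : ContinuousOn g (Icc 0 R)) (hh : ContinuousOn h (Icc 0 R))
    (hlt : ∀ r ∈ Ioo 0 R, g r < h r) : ∫ r in 0..R, g r < ∫ r in 0..R, h r := by
  have hle : ∀ r ∈ Icc 0 R, g r ≤ h r := by
    intro r hr
    have hcl : r ∈ closure (Ioo 0 R) := by rw [closure_Ioo hR.ne]; exact hr
    have hn : (𝓝[Ioo 0 R] r).NeBot := mem_closure_iff_nhdsWithin_neBot.1 hcl
    exact le_of_tendsto_of_tendsto ((hg r hr).mono Ioo_subset_Icc_self)
      ((hh r hr).mono Ioo_subset_Icc_self)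
      (eventually_mem_nhdsWithin.mono fun x hx => (hlt x hx).le)
  refine intervalIntegral.integral_lt_integral_of_continuousOn_of_le_of_exists_lt hR hg hh
    (fun r hr => hle r (Ioc_subset_Icc_self hr)) ⟨R / 2, ⟨by linarith, by linarith⟩, hlt _ ⟨by linarith, by linarith⟩⟩

lemma integral_le_integral_Icc {g h : ℝ → ℝ} {R : ℝ} (hR : 0 ≤ R)
    (hg : ContinuousOn g (Icc 0 R)) (hh : ContinuousOn h (Icc 0 R))
    (hle : ∀ r ∈ Ioo 0 R, g r ≤ h r) : ∫ r in 0..R, g r ≤ ∫ r in 0..R, h r :=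
  intervalIntegral.integral_mono_on_of_le_Ioo hR (hg.intervalIntegrable_of_Icc hR)
    (hh.intervalIntegrable_of_Icc hR) hle

/-! ### The nonlinearity -/

section Nonlinearity

variable {f : ℝ → ℝ}

namespace IsAdmissible

lemma continuous (hf : IsAdmissible f) : Continuous f := hf.contDiff.continuous

lemma hasDerivAt (hf : IsAdmissible f) (u : ℝ) : HasDerivAt f (deriv f u) u :=
  (hf.contDiff.differentiable (by norm_num) u).hasDerivAt

lemma continuous_deriv (hf : IsAdmissible f) : Continuous (deriv f) :=
  hf.contDiff.continuous_deriv le_rfl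

lemma zero (hf : IsAdmissible f) : f 0 = 0 := by
  have := hf.odd 0
  rw [neg_zero] at this
  linarith

lemma strictMonoOn_deriv (hf : IsAdmissible f) : StrictMonoOn (deriv f) (Ici 0) :=
  strictMonoOn_of_deriv_pos (convex_Ici 0) hf.continuous_deriv.continuousOn
    (by simpa using hf.deriv_deriv_pos)

lemma strictMonoOn (hf : IsAdmissible f) : StrictMonoOn f (Ici 0) :=
  strictMonoOn_of_deriv_pos (convex_Ici 0) hf.continuous.continuousOn
    (by simpa using hf.deriv_pos)

lemma sub_bounds (hf : IsAdmissible f) {a b : ℝ} (ha : 0 ≤ a) (hab : a < b) :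
    deriv f a * (b - a) < f b - f a ∧ f b - f a < deriv f b * (b - a) := by
  obtain ⟨c, hc, h⟩ := exists_deriv_eq_slope f hab hf.continuous.continuousOn
    (hf.contDiff.differentiable (by norm_num)).differentiableOn
  have hba : 0 < b - a := by linarith
  rw [eq_div_iff hba.ne'] at h
  rw [← h]
  have hca : 0 ≤ c := ha.trans hc.1.le
  exact ⟨mul_lt_mul_of_pos_right (hf.strictMonoOn_deriv ha hca hc.1) hba,
    mul_lt_mul_of_pos_right (hf.strictMonoOn_deriv hca (ha.trans hab.le) hc.2) hba⟩

lemma lt_deriv_mul (hf : IsAdmissible f) {u : ℝ} (hu : 0 < u) : f u < deriv f u * u := by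
  simpa [hf.zero] using (hf.sub_bounds le_rfl hu).2

/-- This says that `f(s)/s` is strictly increasing, a consequence of convexity and `f 0 = 0`. It
gives the sign in the Wronskian argument. -/
lemma mul_lt_mul (hf : IsAdmissible f) {a b : ℝ} (ha : 0 < a) (hab : a < b) :
    f a * b < f b * a := by
  have h1 := hf.sub_bounds ha.le hab
  have h2 := hf.lt_deriv_mul ha
  nlinarith [mul_lt_mul_of_pos_right h2 (sub_pos.2 hab), mul_lt_mul_of_pos_left h1.1 ha]

lemma one_div_pos (hf : IsAdmissible f) {u : ℝ} (hu : 0 < u) : 0 < 1 / f u :=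
  _root_.one_div_pos.2 (hf.pos u hu)

lemma tailIntegral_sub (hf : IsAdmissible f) {a b : ℝ} (ha : 0 < a) (hb : 0 < b) :
    tailIntegral f a - tailIntegral f b = ∫ s in a..b, 1 / f s :=
  intervalIntegral.integral_Ioi_sub_Ioi' (hf.tail_finite a ha) (hf.tail_finite b hb)

lemma hasDerivAt_tailIntegral (hf : IsAdmissible f) {u : ℝ} (hu : 0 < u) :
    HasDerivAt (tailIntegral f) (-(1 / f u)) u := by
  have hcont : ∀ x > 0, ContinuousAt (fun s => 1 / f s) x := fun x hx =>
    continuousAt_const.div hf.continuous.continuousAt (hf.pos x hx).ne'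
  have h1 : HasDerivAt (fun x => ∫ s in u..x, 1 / f s) (1 / f u) u := by
    refine intervalIntegral.integral_hasDerivAt_right (by simp) ?_ (hcont u hu)
    exact ContinuousOn.stronglyMeasurableAtFilter isOpen_Ioi
      (fun x hx => (hcont x hx).continuousWithinAt) u hu
  refine (h1.const_sub (tailIntegral f u)).congr_of_eventuallyEq ?_
  filter_upwards [Ioi_mem_nhds hu] with x hx
  rw [← hf.tailIntegral_sub hu hx]
  ring

lemma continuousAt_tailIntegral (hf : IsAdmissible f) {u : ℝ} (hu : 0 < u) :
    ContinuousAt (tailIntegral f) u := (hf.hasDerivAt_tailIntegral hu).continuousAt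

lemma strictAntiOn_tailIntegral (hf : IsAdmissible f) :
    StrictAntiOn (tailIntegral f) (Ioi 0) :=
  strictAntiOn_of_deriv_neg (convex_Ioi 0)
    (fun x hx => (hf.continuousAt_tailIntegral hx).continuousWithinAt) fun x hx => by
      rw [interior_Ioi] at hx
      rw [(hf.hasDerivAt_tailIntegral hx).deriv]
      exact neg_neg_of_pos (hf.one_div_pos hx)

lemma tailIntegral_pos (hf : IsAdmissible f) {u : ℝ} (hu : 0 < u) : 0 < tailIntegral f u := by
  have h1 : tailIntegral f (u + 1) < tailIntegral f u :=
    hf.strictAntiOn_tailIntegral hu (by simp; linarith) (by linarith)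
  refine lt_of_le_of_lt ?_ h1
  refine setIntegral_nonneg measurableSet_Ioi fun x hx => (hf.one_div_pos ?_).le
  rw [mem_Ioi] at hx
  linarith

lemma tendsto_tailIntegral (hf : IsAdmissible f) :
    Tendsto (tailIntegral f) atTop (𝓝[>] 0) := by
  refine tendsto_nhdsWithin_iff.2 ⟨?_, ?_⟩
  · have h := intervalIntegral_tendsto_integral_Ioi 1 (hf.tail_finite 1 one_pos) tendsto_id
    have h2 := h.const_sub (tailIntegral f 1)
    rw [show ∫ s in Ioi 1, 1 / f s = tailIntegral f 1 from rfl, sub_self] at h2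
    refine h2.congr' ?_
    filter_upwards [eventually_gt_atTop 0] with x hx
    rw [id, ← hf.tailIntegral_sub one_pos hx]
    ring
  · filter_upwards [eventually_gt_atTop 0] with x hx using hf.tailIntegral_pos hx

end IsAdmissible

end Nonlinearity

/-! ### Radial profiles: a priori bounds and uniqueness -/

/-- The radial equation as a first order system for `u` and `du = u'`. -/
structure IsProfile (N : ℕ) (f : ℝ → ℝ) (α : ℝ) (u du : ℝ → ℝ) : Prop where
  cont : ContinuousOn u (Ici 0)
  dcont : ContinuousOn du (Ici 0)
  hasDerivAt : ∀ r > 0, HasDerivAt u (du r) r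
  hasDerivAt' : ∀ r > 0, HasDerivAt du (-(((N : ℝ) - 1) / r * du r) - f (u r)) r
  init : u 0 = α
  dinit : du 0 = 0

lemma IsRadialSolution.isProfile {N : ℕ} {f : ℝ → ℝ} {α : ℝ} {u : ℝ → ℝ}
    (h : IsRadialSolution N f α u) : IsProfile N f α u (derivWithin u (Ici 0)) where
  cont := h.contDiffOn.continuousOn
  dcont := h.contDiffOn.continuousOn_derivWithin (uniqueDiffOn_Ici 0) (by norm_num)
  hasDerivAt r hr := by
    rw [derivWithin_of_mem_nhds (Ici_mem_nhds hr)]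
    exact (((h.contDiffOn.contDiffAt (Ici_mem_nhds hr)).differentiableAt (by norm_num))).hasDerivAt
  hasDerivAt' r hr := by
    have h2 : ContDiffOn ℝ 1 (deriv u) (Ioi 0) :=
      (h.contDiffOn.mono Ioi_subset_Ici_self).deriv_of_isOpen isOpen_Ioi (by norm_num)
    have h3 : HasDerivAt (deriv u) (deriv (deriv u) r) r :=
      ((h2.contDiffAt (Ioi_mem_nhds hr)).differentiableAt (by norm_num)).hasDerivAt
    have heq : ∀ s > 0, derivWithin u (Ici 0) s = deriv u s := fun s hs =>
      derivWithin_of_mem_nhds (Ici_mem_nhds hs)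
    rw [heq r hr]
    refine (h3.congr_of_eventuallyEq ?_).congr_deriv (by linarith [h.ode r hr])
    filter_upwards [Ioi_mem_nhds hr] with s hs using heq s hs
  init := h.init
  dinit := h.deriv_init

/-- Energy bound: solutions never leave the interval `[-|α|, |α|]`. -/
lemma IsProfile.abs_le_init {N : ℕ} (hN : 1 ≤ N) {g : ℝ → ℝ} (hg : Continuous g)
    (hodd : ∀ x, g (-x) = -g x) (hpos : ∀ x > 0, 0 < g x) {α : ℝ} {u du : ℝ → ℝ}
    (h : IsProfile N g α u du) {r : ℝ} (hr : 0 ≤ r) : |u r| ≤ |α| := by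
  set G : ℝ → ℝ := fun x => ∫ s in 0..x, g s with hG
  have hGd : ∀ x, HasDerivAt G (g x) x := fun x => hg.integral_hasStrictDerivAt 0 x |>.hasDerivAt
  have hGc : Continuous G := continuous_iff_continuousAt.2 fun x => (hGd x).continuousAt
  have hGeven : ∀ x, G |x| = G x := by
    intro x
    rcases abs_choice x with h | h <;> rw [h]
    have h1 := intervalIntegral.integral_comp_neg (a := 0) (b := x) g
    simp only [hodd, intervalIntegral.integral_neg, neg_zero] at h1
    simp only [hG]
    rw [intervalIntegral.integral_symm, ← h1, neg_neg]
  have hGmono : StrictMonoOn G (Ici 0) :=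
    strictMonoOn_of_deriv_pos (convex_Ici 0) hGc.continuousOn fun x hx => by
      rw [interior_Ici] at hx
      rw [(hGd x).deriv]
      exact hpos x hx
  -- The term `(N-1)u'/r` acts as friction, so the energy decreases; the potential part alone is
  -- then at most `G α`.
  have hE : AntitoneOn (fun r => du r ^ 2 / 2 + G (u r)) (Ici 0) := by
    have hd : ∀ r > 0, HasDerivAt (fun r => du r ^ 2 / 2 + G (u r))
        (-(((N : ℝ) - 1) / r * du r ^ 2)) r := by
      intro r hr
      have := (((h.hasDerivAt' r hr).pow 2).div_const 2).add ((hGd (u r)).comp r (h.hasDerivAt r hr))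
      convert! this using 1
      push_cast
      ring
    refine antitoneOn_of_deriv_nonpos (convex_Ici 0) ?_ ?_ ?_
    · exact ((h.dcont.pow 2).div_const 2).add (hGc.comp_continuousOn h.cont)
    · intro x hx
      rw [interior_Ici] at hx
      exact (hd x hx).differentiableAt.differentiableWithinAt
    · intro x hx
      rw [interior_Ici] at hx
      rw [(hd x hx).deriv]
      have : (1 : ℝ) ≤ N := by exact_mod_cast hN
      have : 0 ≤ ((N : ℝ) - 1) / x := div_nonneg (by linarith) (le_of_lt hx)
      have := mul_nonneg this (sq_nonneg (du x))
      linarith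
  have h1 := hE (mem_Ici.2 le_rfl) (mem_Ici.2 hr) hr
  simp only [h.init, h.dinit] at h1
  by_contra! hlt
  have h2 := hGmono (mem_Ici.2 (abs_nonneg α)) (mem_Ici.2 (abs_nonneg (u r))) hlt
  rw [hGeven, hGeven] at h2
  nlinarith [sq_nonneg (du r)]

/-- Continuous dependence on the initial value. -/
lemma IsProfile.sq_sub_le {N : ℕ} (hN : 1 ≤ N) {g : ℝ → ℝ} {α β : ℝ} {u du v dv : ℝ → ℝ}
    (hu : IsProfile N g α u du) (hv : IsProfile N g β v dv) {L : ℝ} (hL : 0 ≤ L)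
    (hlip : ∀ r ≥ 0, |g (u r) - g (v r)| ≤ L * |u r - v r|) {r : ℝ} (hr : 0 ≤ r) :
    (u r - v r) ^ 2 ≤ Real.exp ((L + 1) * r) * (α - β) ^ 2 := by
  set E : ℝ → ℝ := fun r => Real.exp (-((L + 1) * r)) * ((u r - v r) ^ 2 + (du r - dv r) ^ 2)
    with hEdef
  have hd : ∀ r > 0, HasDerivAt E (Real.exp (-((L + 1) * r)) *
      (-(L + 1) * ((u r - v r) ^ 2 + (du r - dv r) ^ 2) + 2 * (u r - v r) * (du r - dv r)
      - 2 * (du r - dv r) * (((N : ℝ) - 1) / r * (du r - dv r) + (g (u r) - g (v r))))) r := by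
    intro r hr
    have h1 := ((hu.hasDerivAt r hr).sub (hv.hasDerivAt r hr)).pow 2
    have h2 := ((hu.hasDerivAt' r hr).sub (hv.hasDerivAt' r hr)).pow 2
    have h3 : HasDerivAt (fun r => Real.exp (-((L + 1) * r)))
        (Real.exp (-((L + 1) * r)) * (-((L + 1) * 1))) r :=
      (((hasDerivAt_id r).const_mul (L + 1)).neg).exp
    convert! h3.mul (h1.add h2) using 1
    push_cast
    simp only [Pi.sub_apply, Pi.add_apply, Pi.pow_apply]
    ring
  -- The friction term has a good sign and is dropped; the weight `exp(-(L+1)r)` absorbs the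
  -- remaining cross terms.
  have hE : AntitoneOn E (Ici 0) := by
    refine antitoneOn_of_deriv_nonpos (convex_Ici 0) ?_ ?_ ?_
    · exact (Continuous.continuousOn (by fun_prop)).mul
        (((hu.cont.sub hv.cont).pow 2).add ((hu.dcont.sub hv.dcont).pow 2))
    · intro x hx
      rw [interior_Ici] at hx
      exact (hd x hx).differentiableAt.differentiableWithinAt
    · intro x hx
      rw [interior_Ici] at hx
      rw [(hd x hx).deriv]
      refine mul_nonpos_of_nonneg_of_nonpos (Real.exp_pos _).le ?_
      have h1 : (1 : ℝ) ≤ N := by exact_mod_cast hN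
      have h2 : 0 ≤ ((N : ℝ) - 1) / x * (du x - dv x) ^ 2 :=
        mul_nonneg (div_nonneg (by linarith) (le_of_lt hx)) (sq_nonneg _)
      have h3 := hlip x (le_of_lt hx)
      have h4 : -(du x - dv x) * (g (u x) - g (v x)) ≤ |du x - dv x| * (L * |u x - v x|) := by
        refine (le_abs_self _).trans ?_
        rw [abs_mul, abs_neg]
        gcongr
      have h5 : (u x - v x) * (du x - dv x) ≤ |u x - v x| * |du x - dv x| := by
        rw [← abs_mul]; exact le_abs_self _
      have h6 := mul_nonneg (by linarith : 0 ≤ L + 1) (sq_nonneg (|u x - v x| - |du x - dv x|))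
      rw [← sq_abs (u x - v x), ← sq_abs (du x - dv x)]
      rw [← sq_abs (du x - dv x)] at h2
      have h7 : 2 * (du x - dv x) * (((N : ℝ) - 1) / x * (du x - dv x) + (g (u x) - g (v x)))
          = 2 * (((N : ℝ) - 1) / x * |du x - dv x| ^ 2) +
            2 * ((du x - dv x) * (g (u x) - g (v x))) := by rw [sq_abs]; ring
      rw [h7]
      nlinarith
  have h1 := hE (mem_Ici.2 le_rfl) (mem_Ici.2 hr) hr
  simp only [hEdef, hu.init, hu.dinit, hv.init, hv.dinit, mul_zero, neg_zero, Real.exp_zero,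
    one_mul, sub_self] at h1
  rw [Real.exp_neg, inv_mul_le_iff₀ (Real.exp_pos _)] at h1
  nlinarith [sq_nonneg (du r - dv r)]

lemma IsAdmissible.exists_lipschitz {f : ℝ → ℝ} (hf : IsAdmissible f) (B : ℝ) :
    ∃ L : ℝ, 0 < L ∧ ∀ x ∈ Icc (-B) B, ∀ y ∈ Icc (-B) B, |f x - f y| ≤ L * |x - y| := by
  obtain ⟨C, hC⟩ := isCompact_Icc.exists_bound_of_continuousOn (s := Icc (-B) B)
    hf.continuous_deriv.continuousOn
  refine ⟨max C 1, by positivity, fun x hx y hy => ?_⟩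
  have := (convex_Icc (-B) B).norm_image_sub_le_of_norm_deriv_le (f := f) (C := max C 1)
    (fun z _ => hf.contDiff.differentiable (by norm_num) z)
    (fun z hz => (hC z hz).trans (le_max_left _ _)) hy hx
  simpa using this

lemma IsProfile.eqOn {N : ℕ} (hN : 1 ≤ N) {f : ℝ → ℝ} (hf : IsAdmissible f) {α : ℝ}
    {u du v dv : ℝ → ℝ} (hu : IsProfile N f α u du) (hv : IsProfile N f α v dv) :
    EqOn v u (Ici 0) := by
  obtain ⟨L, hL, hlip⟩ := hf.exists_lipschitz |α|
  intro r hr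
  have h := hu.sq_sub_le hN hv hL.le (fun r hr => hlip _
    (abs_le.1 (hu.abs_le_init hN hf.continuous hf.odd hf.pos hr)) _
    (abs_le.1 (hv.abs_le_init hN hf.continuous hf.odd hf.pos hr))) hr
  rw [sub_self, zero_pow two_ne_zero, mul_zero] at h
  have := pow_eq_zero_iff two_ne_zero |>.1 (le_antisymm h (sq_nonneg _))
  linarith

/-! ### Existence -/

/-- The weighted average `∫₀¹ τᵏ h(rτ) dτ`. -/
noncomputable def avg (k : ℕ) (h : ℝ → ℝ) (r : ℝ) : ℝ := ∫ τ in (0 : ℝ)..1, τ ^ k * h (r * τ)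

lemma continuous_avg (k : ℕ) {h : ℝ → ℝ} (hh : Continuous h) : Continuous (avg k h) :=
  intervalIntegral.continuous_parametric_intervalIntegral_of_continuous' (by fun_prop) 0 1

/-- Thus `r * avg n h r` equals `r⁻ⁿ ∫₀ʳ tⁿ h` for `r ≠ 0`, but it is also regular at `r = 0`.
Written with `avg`, the radial integral equation has no singular coefficient. -/
lemma pow_mul_avg (k : ℕ) (h : ℝ → ℝ) (r : ℝ) :
    r ^ (k + 1) * avg k h r = ∫ t in 0..r, t ^ k * h t := by
  rcases eq_or_ne r 0 with rfl | hr
  · simp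
  have h1 := intervalIntegral.integral_comp_mul_left (a := 0) (b := 1)
    (fun t => t ^ k * h t) hr
  simp only [mul_zero, mul_one, smul_eq_mul, mul_pow] at h1
  rw [eq_inv_mul_iff_mul_eq₀ hr] at h1
  rw [← h1, avg, pow_succ', mul_assoc, ← intervalIntegral.integral_const_mul]
  simp only [mul_assoc]

lemma abs_avg_sub_le (k : ℕ) {h₁ h₂ b : ℝ → ℝ} (hh₁ : Continuous h₁) (hh₂ : Continuous h₂)
    (hb : Continuous b) {r : ℝ} (hle : ∀ τ ∈ Icc (0 : ℝ) 1, |h₁ (r * τ) - h₂ (r * τ)| ≤ b (r * τ)) :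
    |avg k h₁ r - avg k h₂ r| ≤ avg k b r := by
  rw [avg, avg, ← intervalIntegral.integral_sub
    (Continuous.intervalIntegrable (by fun_prop) _ _)
    (Continuous.intervalIntegrable (by fun_prop) _ _)]
  change ‖(_ : ℝ)‖ ≤ ∫ τ in (0 : ℝ)..1, τ ^ k * b (r * τ)
  refine intervalIntegral.norm_integral_le_of_norm_le zero_le_one
    (.of_forall fun τ hτ => ?_) ?_
  · rw [← mul_sub, Real.norm_eq_abs, abs_mul, abs_of_nonneg (pow_nonneg hτ.1.le k)]
    exact mul_le_mul_of_nonneg_left (hle τ (Ioc_subset_Icc_self hτ)) (pow_nonneg hτ.1.le k)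
  · exact Continuous.intervalIntegrable (by fun_prop) _ _

lemma avg_le_of_le (k : ℕ) {b : ℝ → ℝ} (hb : Continuous b) {r C : ℝ} (hC : 0 ≤ C)
    (hle : ∀ τ ∈ Icc (0 : ℝ) 1, b (r * τ) ≤ C) : avg k b r ≤ C := by
  have : avg k b r ≤ ∫ τ in (0 : ℝ)..1, C := by
    refine intervalIntegral.integral_mono_on zero_le_one
      (Continuous.intervalIntegrable (by fun_prop) _ _) (by simp) fun τ hτ => ?_
    calc τ ^ k * b (r * τ) ≤ τ ^ k * C :=
          mul_le_mul_of_nonneg_left (hle τ hτ) (pow_nonneg hτ.1 k)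
      _ ≤ 1 * C := mul_le_mul_of_nonneg_right (pow_le_one₀ hτ.1 hτ.2) hC
      _ = C := one_mul C
  simpa using this

/-- With `h = g ∘ u`, the function `-(r * avg n h r)` is `u'`, so this computes `u''`. At the origin
the difference quotient is `avg n h` itself, whose value there is `h 0 / (n + 1)`. -/
lemma hasDerivAt_mul_avg (n : ℕ) {h : ℝ → ℝ} (hh : Continuous h) (r : ℝ) :
    HasDerivAt (fun r => r * avg n h r) (h r - n * avg n h r) r := by
  rcases eq_or_ne r 0 with rfl | hr
  · have h0 : avg n h 0 = h 0 / (n + 1) := by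
      simp [avg, intervalIntegral.integral_mul_const, integral_pow]
      ring
    have h1 : h 0 - n * avg n h 0 = avg n h 0 := by
      rw [h0]; field_simp; ring
    rw [h1, hasDerivAt_iff_tendsto_slope]
    refine ((continuous_avg n hh).continuousWithinAt (s := {0}ᶜ)).tendsto.congr' ?_
    filter_upwards [self_mem_nhdsWithin] with x hx
    rw [slope_def_field]
    have : x ≠ 0 := hx
    field_simp
    ring
  · have hI : HasDerivAt (fun r => ∫ t in 0..r, t ^ n * h t) (r ^ n * h r) r :=
      (Continuous.integral_hasStrictDerivAt (by fun_prop) 0 r).hasDerivAt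
    have hq := hI.div (hasDerivAt_pow n r) (pow_ne_zero n hr)
    have heq : (fun r => r * avg n h r) =ᶠ[𝓝 r]
        fun r => (∫ t in 0..r, t ^ n * h t) / r ^ n := by
      filter_upwards [isOpen_ne.mem_nhds hr] with x hx
      rw [← pow_mul_avg, pow_succ]
      field_simp [pow_ne_zero n hx]
    refine (hq.congr_of_eventuallyEq heq).congr_deriv ?_
    rw [← pow_mul_avg]
    rcases n with _ | m
    · simp
    · field_simp
      simp only [Nat.add_sub_cancel]
      ring

/-- The fixed-point equation is the radial ODE integrated twice. Writing `u = α + exp(Lr²) w` with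
`w` bounded makes the integral operator a contraction on the whole line at once, so no continuation
argument is needed. -/
lemma exists_fixed_point (n : ℕ) {g : ℝ → ℝ} (hg : Continuous g) {B L : ℝ} (hL : 0 < L)
    (hB : ∀ x, |g x| ≤ B) (hlip : ∀ x y, |g x - g y| ≤ L * |x - y|) (α : ℝ) :
    ∃ u : ℝ → ℝ, Continuous u ∧ ∀ r, u r = α - r ^ 2 * avg 1 (avg n fun t => g (u t)) r := by
  set U : BoundedContinuousFunction ℝ ℝ → ℝ → ℝ := fun w r => α + Real.exp (L * r ^ 2) * w r
  have hU : ∀ w, Continuous (U w) := fun w => by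
    have := w.continuous
    fun_prop
  set A : BoundedContinuousFunction ℝ ℝ → ℝ → ℝ := fun w r => avg 1 (avg n fun t => g (U w t)) r
  have hgU : ∀ w, Continuous fun t => g (U w t) := fun w => hg.comp (hU w)
  have hA : ∀ w, Continuous (A w) := fun w => continuous_avg 1 (continuous_avg n (hgU w))
  have hB0 : 0 ≤ B := (abs_nonneg _).trans (hB 0)
  have hexp : ∀ r : ℝ, Real.exp (-(L * r ^ 2)) * r ^ 2 ≤ 1 / L := by
    intro r
    rw [Real.exp_neg, inv_mul_le_iff₀ (Real.exp_pos _)]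
    have := Real.add_one_le_exp (L * r ^ 2)
    rw [mul_one_div, le_div_iff₀ hL]
    linarith
  have hAb : ∀ w r, |A w r| ≤ B := by
    intro w r
    have h0 : ∀ k r, avg k (fun _ => (0 : ℝ)) r = 0 := by simp [avg]
    have h1 : ∀ s, |avg n (fun t => g (U w t)) s| ≤ B := by
      intro s
      have := abs_avg_sub_le n (hgU w) continuous_const (b := fun _ => B) continuous_const
        (r := s) (h₂ := fun _ => 0) (fun τ _ => by simpa using hB _)
      rw [h0, sub_zero] at this
      exact this.trans (avg_le_of_le n continuous_const hB0 fun _ _ => le_rfl)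
    have := abs_avg_sub_le 1 (continuous_avg n (hgU w)) continuous_const (b := fun _ => B)
      continuous_const (r := r) (h₂ := fun _ => 0) (fun τ _ => by simpa using h1 _)
    rw [h0, sub_zero] at this
    exact this.trans (avg_le_of_le 1 continuous_const hB0 fun _ _ => le_rfl)
  set T : BoundedContinuousFunction ℝ ℝ → BoundedContinuousFunction ℝ ℝ := fun w =>
    BoundedContinuousFunction.ofNormedAddCommGroup
      (fun r => -(Real.exp (-(L * r ^ 2)) * r ^ 2 * A w r))
      (by have := hA w; fun_prop) (1 / L * B) (fun r => by
        rw [norm_neg, norm_mul, Real.norm_eq_abs, Real.norm_eq_abs,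
          abs_of_nonneg (by positivity : 0 ≤ Real.exp (-(L * r ^ 2)) * r ^ 2)]
        exact mul_le_mul (hexp r) (hAb w r) (abs_nonneg _) (by positivity)) with hT
  have hTapp : ∀ w r, T w r = -(Real.exp (-(L * r ^ 2)) * r ^ 2 * A w r) := fun w r => rfl
  have hcontr : ContractingWith (1 / 2) T := by
    refine ⟨by norm_num [← NNReal.coe_lt_coe], LipschitzWith.of_dist_le_mul fun w₁ w₂ => ?_⟩
    rw [BoundedContinuousFunction.dist_le (by positivity)]
    intro r
    set D := dist w₁ w₂
    set b : ℝ → ℝ := fun t => L * D * Real.exp (L * t ^ 2) with hb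
    have hbc : Continuous b := by fun_prop
    have h1 : ∀ t, |g (U w₁ t) - g (U w₂ t)| ≤ b t := by
      intro t
      refine (hlip _ _).trans ?_
      have hw : |w₁ t - w₂ t| ≤ D :=
        BoundedContinuousFunction.dist_coe_le_dist (f := w₁) (g := w₂) t
      have : U w₁ t - U w₂ t = Real.exp (L * t ^ 2) * (w₁ t - w₂ t) := by simp only [U]; ring
      rw [this, abs_mul, abs_of_pos (Real.exp_pos _), hb]
      calc L * (Real.exp (L * t ^ 2) * |w₁ t - w₂ t|) ≤ L * (Real.exp (L * t ^ 2) * D) := by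
            gcongr
        _ = _ := by ring
    have h2 : ∀ s, |avg n (fun t => g (U w₁ t)) s - avg n (fun t => g (U w₂ t)) s| ≤ b s := by
      intro s
      refine (abs_avg_sub_le n (hgU w₁) (hgU w₂) hbc fun τ _ => h1 _).trans ?_
      refine avg_le_of_le n hbc (by positivity) fun τ hτ => ?_
      have : τ ^ 2 ≤ 1 := pow_le_one₀ hτ.1 hτ.2
      have : (s * τ) ^ 2 ≤ s ^ 2 := by nlinarith [sq_nonneg s]
      simp only [hb]
      gcongr
    have h3 : |A w₁ r - A w₂ r| ≤ avg 1 b r :=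
      abs_avg_sub_le 1 (continuous_avg n (hgU w₁)) (continuous_avg n (hgU w₂)) hbc fun τ _ => h2 _
    -- The ratio `1/2` arises here: `∫₀ʳ t L exp(Lt²) dt = (exp(Lr²) - 1)/2`.
    have h4 : r ^ 2 * avg 1 b r = D / 2 * (Real.exp (L * r ^ 2) - 1) := by
      have := pow_mul_avg 1 b r
      rw [this]
      have hder : ∀ t ∈ uIcc 0 r, HasDerivAt (fun t => D / 2 * Real.exp (L * t ^ 2))
          (t ^ 1 * b t) t := by
        intro t _
        have := ((((hasDerivAt_id t).pow 2).const_mul L).exp).const_mul (D / 2)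
        convert! this using 1
        simp [hb]
        ring
      rw [intervalIntegral.integral_eq_sub_of_hasDerivAt hder
        (Continuous.intervalIntegrable (by fun_prop) _ _)]
      simp
      ring
    rw [hTapp, hTapp, Real.dist_eq]
    have h5 : -(Real.exp (-(L * r ^ 2)) * r ^ 2 * A w₁ r) - -(Real.exp (-(L * r ^ 2)) * r ^ 2 * A w₂ r)
        = -(Real.exp (-(L * r ^ 2)) * (r ^ 2 * (A w₁ r - A w₂ r))) := by ring
    rw [h5, abs_neg, abs_mul, abs_mul, abs_of_pos (Real.exp_pos _), abs_of_nonneg (sq_nonneg r),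
      Real.exp_neg, inv_mul_le_iff₀ (Real.exp_pos _)]
    have h6 : r ^ 2 * |A w₁ r - A w₂ r| ≤ r ^ 2 * avg 1 b r := by gcongr
    have hD : 0 ≤ D := dist_nonneg
    have : ((1 / 2 : NNReal) : ℝ) = 1 / 2 := by norm_num
    rw [this]
    linarith
  set w := hcontr.fixedPoint T
  have hw : T w = w := hcontr.fixedPoint_isFixedPt
  refine ⟨U w, hU w, fun r => ?_⟩
  have h1 : w r = -(Real.exp (-(L * r ^ 2)) * r ^ 2 * A w r) := by rw [← hTapp, hw]
  have h2 : U w r = α + Real.exp (L * r ^ 2) * w r := rfl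
  rw [h2, h1, Real.exp_neg]
  have := (Real.exp_pos (L * r ^ 2)).ne'
  field_simp
  ring

lemma exists_solution_of_lipschitz (n : ℕ) {g : ℝ → ℝ} (hg : Continuous g) {B L : ℝ} (hL : 0 < L)
    (hB : ∀ x, |g x| ≤ B) (hlip : ∀ x y, |g x - g y| ≤ L * |x - y|) (α : ℝ) :
    ∃ u : ℝ → ℝ, IsRadialSolution (n + 1) g α u := by
  obtain ⟨u, hu, hfix⟩ := exists_fixed_point n hg hL hB hlip α
  set h : ℝ → ℝ := fun t => g (u t)
  have hh : Continuous h := hg.comp hu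
  have hM : Continuous (avg n h) := continuous_avg n hh
  have hu' : ∀ r, HasDerivAt u (-(r * avg n h r)) r := by
    intro r
    have h1 : HasDerivAt (fun r => ∫ t in 0..r, t ^ 1 * avg n h t) (r ^ 1 * avg n h r) r :=
      (Continuous.integral_hasStrictDerivAt (by fun_prop) 0 r).hasDerivAt
    have h2 := (h1.const_sub α)
    rw [pow_one] at h2
    refine h2.congr_of_eventuallyEq (.of_forall fun x => ?_)
    rw [hfix x]
    exact congrArg (α - ·) (pow_mul_avg 1 (avg n h) x)
  have hd : deriv u = fun r => -(r * avg n h r) := funext fun r => (hu' r).deriv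
  have hu'' : ∀ r, HasDerivAt (deriv u) (-(h r - n * avg n h r)) r := by
    intro r
    rw [hd]
    exact (hasDerivAt_mul_avg n hh r).neg
  have hdd : deriv (deriv u) = fun r => -(h r - n * avg n h r) := funext fun r => (hu'' r).deriv
  have hC : ContDiff ℝ 2 u := by
    rw [show (2 : WithTop ℕ∞) = 1 + 1 from by norm_num, contDiff_succ_iff_deriv]
    refine ⟨fun r => (hu' r).differentiableAt, by simp, ?_⟩
    rw [contDiff_one_iff_deriv]
    refine ⟨fun r => (hu'' r).differentiableAt, ?_⟩
    rw [hdd]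
    fun_prop
  refine ⟨u, hC.contDiffOn, fun r hr => ?_, ?_, ?_⟩
  · rw [hdd, hd]
    push_cast
    simp only [h]
    field_simp
    ring
  · rw [hfix]; simp
  · rw [((hu' 0).hasDerivWithinAt).derivWithin (uniqueDiffOn_Ici 0 0 self_mem_Ici)]
    simp

/-- Composing `f` with the clamp to `[-α, α]` makes it bounded and globally Lipschitz while keeping
it odd and positive on `(0,∞)`. The energy bound then confines the solution to the range where the
clamp is the identity. -/
lemma exists_isRadialSolution {N : ℕ} (hN : 1 ≤ N) {f : ℝ → ℝ} (hf : IsAdmissible f) {α : ℝ}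
    (hα : 0 < α) : ∃ u : ℝ → ℝ, IsRadialSolution N f α u := by
  obtain ⟨n, rfl⟩ : ∃ n, N = n + 1 := ⟨N - 1, by omega⟩
  obtain ⟨L, hL, hlip⟩ := hf.exists_lipschitz α
  set c : ℝ → ℝ := fun x => max (-α) (min α x) with hc
  have hcm : ∀ x, c x ∈ Icc (-α) α := fun x =>
    ⟨le_max_left _ _, max_le (by linarith) (min_le_left _ _)⟩
  have hcl : ∀ x y, |c x - c y| ≤ |x - y| := fun x y =>
    (abs_max_sub_max_le_max (-α) (min α x) (-α) (min α y)).trans <| by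
      have := abs_min_sub_min_le_max α x α y
      simp only [sub_self, abs_zero] at this ⊢
      rw [max_eq_right (abs_nonneg _)] at this ⊢
      exact this
  have hcc : Continuous c := by fun_prop
  have hodd : ∀ x, c (-x) = -c x := by
    intro x
    simp only [hc]
    rcases le_total x (-α) with h | h <;> rcases le_total x α with h' | h' <;>
      simp only [max_def, min_def] <;> split_ifs <;> linarith
  obtain ⟨C, hC⟩ := isCompact_Icc.exists_bound_of_continuousOn (s := Icc (-α) α)
    hf.continuous.continuousOn
  obtain ⟨u, hu⟩ := exists_solution_of_lipschitz n (g := fun x => f (c x)) (hf.continuous.comp hcc)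
    hL (fun x => hC _ (hcm x)) (fun x y => (hlip _ (hcm x) _ (hcm y)).trans
      (mul_le_mul_of_nonneg_left (hcl x y) hL.le)) α
  have hb : ∀ r ≥ 0, |u r| ≤ α := fun r hr => by
    have := hu.isProfile.abs_le_init hN (hf.continuous.comp hcc)
      (fun x => by simp only [Function.comp, hodd, hf.odd])
      (fun x hx => hf.pos _ (lt_max_of_lt_right (lt_min hα hx))) hr
    rwa [abs_of_pos hα] at this
  refine ⟨u, hu.contDiffOn, fun r hr => ?_, hu.init, hu.deriv_init⟩
  have h1 := abs_le.1 (hb r (le_of_lt hr))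
  have h2 : c (u r) = u r := by simp only [hc]; rw [min_eq_right h1.2, max_eq_right h1.1]
  have h3 := hu.ode r hr
  simp only [h2] at h3
  exact h3

/-! ### Hardy's inequality and a sufficient condition for stability -/

/-- Hardy's inequality in one variable; the weights are those of dimension `N = n + 3`. -/
lemma hardy_interval (n : ℕ) {g dg : ℝ → ℝ} {R : ℝ} (hR : 0 ≤ R)
    (hg : ContinuousOn g (Icc 0 R)) (hdg : ContinuousOn dg (Icc 0 R))
    (hd : ∀ r ∈ Ioo 0 R, HasDerivAt g (dg r) r) (hgR : g R = 0) :
    ∫ r in 0..R, (((n : ℝ) + 1) / 2) ^ 2 * (r ^ n * g r ^ 2) ≤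
      ∫ r in 0..R, r ^ (n + 2) * dg r ^ 2 := by
  set a : ℝ := ((n : ℝ) + 1) / 2 with ha
  -- This is the derivative of `a rⁿ⁺¹ g²`, which vanishes at both endpoints. Adding it to the
  -- difference of the two integrands produces the square `rⁿ (r g' + a g)²`.
  set dG : ℝ → ℝ := fun r => 2 * a ^ 2 * (r ^ n * g r ^ 2) + 2 * a * (r ^ (n + 1) * (g r * dg r))
  have hpow : ∀ k : ℕ, ContinuousOn (fun r : ℝ => r ^ k) (Icc 0 R) := fun k => by fun_prop
  have hdGc : ContinuousOn dG (Icc 0 R) :=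
    (continuousOn_const.mul ((hpow n).mul (hg.pow 2))).add
      (continuousOn_const.mul ((hpow (n + 1)).mul (hg.mul hdg)))
  have h0 : ∫ r in 0..R, dG r = 0 := by
    rw [integral_eq_sub_of_hasDerivAt_Ioo (g := fun r => a * (r ^ (n + 1) * g r ^ 2)) hR
      (continuousOn_const.mul ((hpow _).mul (hg.pow 2))) ?_ hdGc]
    · simp [hgR]
    · intro r hr
      have := (((hasDerivAt_id r).pow (n + 1)).mul ((hd r hr).pow 2)).const_mul a
      convert! this using 1
      simp only [dG, ha, Nat.add_sub_cancel, id]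
      push_cast
      simp
      ring
  have h1 : ContinuousOn (fun r => a ^ 2 * (r ^ n * g r ^ 2)) (Icc 0 R) :=
    continuousOn_const.mul ((hpow n).mul (hg.pow 2))
  have h2 : ContinuousOn (fun r => r ^ (n + 2) * dg r ^ 2) (Icc 0 R) :=
    (hpow (n + 2)).mul (hdg.pow 2)
  have h3 := integral_le_integral_Icc hR h1 (h2.add hdGc) (fun r hr => by
    have : 0 ≤ r ^ n * (r * dg r + a * g r) ^ 2 :=
      mul_nonneg (pow_nonneg hr.1.le n) (sq_nonneg _)
    have h4 : r ^ (n + 2) * dg r ^ 2 + dG r - a ^ 2 * (r ^ n * g r ^ 2)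
        = r ^ n * (r * dg r + a * g r) ^ 2 := by
      simp only [dG]; ring
    show _ ≤ r ^ (n + 2) * dg r ^ 2 + dG r
    linarith)
  have h5 := intervalIntegral.integral_add (μ := volume) (h2.intervalIntegrable_of_Icc hR)
    (hdGc.intervalIntegrable_of_Icc hR)
  rw [h0, add_zero] at h5
  rw [← h5]
  exact h3

/-- Nonnegativity of an integral from nonnegativity along rays. -/
lemma integral_nonneg_of_rays {E : Type*} [NormedAddCommGroup E] [NormedSpace ℝ E]
    [FiniteDimensional ℝ E] [Nontrivial E] [MeasurableSpace E] [BorelSpace E] (μ : Measure E)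
    [μ.IsAddHaarMeasure] (G : E → ℝ)
    (h : ∀ θ : E, ‖θ‖ = 1 →
      0 ≤ ∫ r in Ioi (0 : ℝ), r ^ (Module.finrank ℝ E - 1) * G (r • θ)) : 0 ≤ ∫ x, G x ∂μ := by
  have hpol : ∫ x, G x ∂μ = ∫ p : Metric.sphere (0 : E) 1 × Ioi (0 : ℝ), G (p.2.1 • p.1.1)
      ∂(μ.toSphere.prod (.volumeIoiPow (Module.finrank ℝ E - 1))) := by
    calc ∫ x, G x ∂μ = ∫ x : ({(0 : E)}ᶜ : Set E), G x.1 ∂(μ.comap (↑)) := by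
          rw [integral_subtype_comap (measurableSet_singleton _).compl fun x => G x,
            restrict_compl_singleton]
      _ = _ := by
          rw [← μ.measurePreserving_homeomorphUnitSphereProd.integral_comp
            (Homeomorph.measurableEmbedding _) (fun p => G (p.2.1 • p.1.1))]
          congr 1
          ext x
          have hx : ‖x.1‖ ≠ 0 := norm_ne_zero_iff.2 x.2
          simp [smul_smul, hx]
  rw [hpol]
  by_cases hint : Integrable (fun p : Metric.sphere (0 : E) 1 × Ioi (0 : ℝ) => G (p.2.1 • p.1.1))
      (μ.toSphere.prod (.volumeIoiPow (Module.finrank ℝ E - 1)))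
  · rw [integral_prod _ hint]
    refine integral_nonneg fun θ => ?_
    have h1 := h θ.1 (by simp)
    refine h1.trans_eq ?_
    simp only [Measure.volumeIoiPow, ENNReal.ofReal]
    rw [integral_withDensity_eq_integral_smul,
      integral_subtype_comap measurableSet_Ioi
        fun a => Real.toNNReal (a ^ (Module.finrank ℝ E - 1)) • G (a • θ.1)]
    · refine setIntegral_congr_fun measurableSet_Ioi fun x hx => ?_
      simp only [NNReal.smul_def, smul_eq_mul]
      rw [Real.coe_toNNReal _ (pow_nonneg hx.out.le _)]
    · exact (measurable_subtype_coe.pow_const _).real_toNNReal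
  -- A non-integrable function has Bochner integral `0`, so the lemma needs no integrability
  -- hypothesis.
  · rw [integral_undef hint]

lemma continuous_comp_norm {N : ℕ} {h : ℝ → ℝ} (hh : ContinuousOn h (Ici 0)) :
    Continuous fun x : EuclideanSpace ℝ (Fin N) => h ‖x‖ :=
  hh.comp_continuous continuous_norm fun x => norm_nonneg x

lemma continuous_gradient {N : ℕ} {φ : EuclideanSpace ℝ (Fin N) → ℝ} (hφ : ContDiff ℝ 1 φ) :
    Continuous (gradient φ) :=
  (InnerProductSpace.toDual ℝ _).symm.continuous.comp (hφ.continuous_fderiv (by norm_num))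

lemma gradient_eq_zero_of_notMem_tsupport {N : ℕ} {φ : EuclideanSpace ℝ (Fin N) → ℝ}
    {x : EuclideanSpace ℝ (Fin N)} (hx : x ∉ tsupport φ) : gradient φ x = 0 := by
  have : fderiv ℝ φ x = 0 := by
    by_contra h
    exact hx (support_fderiv_subset ℝ h)
  simp [gradient, this]

/-- Stability from the Hardy bound `r² f'(u(r)) ≤ (N - 2)² / 4`. -/
lemma isStable_of_hardy {N : ℕ} (hN : 3 ≤ N) {f u : ℝ → ℝ} (hf : Continuous (deriv f))
    (hu : ContinuousOn u (Ici 0))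
    (hV : ∀ r > 0, r ^ 2 * deriv f (u r) ≤ (((N : ℝ) - 2) / 2) ^ 2) :
    IsStable f (radial N u) := by
  obtain ⟨n, rfl⟩ : ∃ n, N = n + 3 := ⟨N - 3, by omega⟩
  intro φ hφ hsupp
  have hV' : ContinuousOn (fun r => deriv f (u r)) (Ici 0) := hf.comp_continuousOn hu
  have hφ0 : ∀ x ∉ tsupport φ, φ x = 0 := fun x hx => image_eq_zero_of_notMem_tsupport hx
  obtain ⟨R, hRpos, hR⟩ := hsupp.isBounded.subset_closedBall_lt 0 0
  refine integral_nonneg_of_rays _ _ fun θ hθ => ?_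
  rw [finrank_euclideanSpace_fin]
  set G : ℝ → ℝ := fun r => r ^ (n + 3 - 1) *
    (‖gradient φ (r • θ)‖ ^ 2 - deriv f (radial (n + 3) u (r • θ)) * φ (r • θ) ^ 2) with hG
  have hnorm : ∀ r ≥ 0, ‖r • θ‖ = r := fun r hr => by
    rw [norm_smul, hθ, mul_one, Real.norm_of_nonneg hr]
  have hout : ∀ r > R, r • θ ∉ tsupport φ := fun r hr hmem => by
    have := hR hmem
    rw [mem_closedBall_zero_iff, hnorm r (hRpos.le.trans hr.le)] at this
    linarith
  have hcut : ∫ r in Ioi 0, G r = ∫ r in 0..R, G r := by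
    rw [intervalIntegral.integral_of_le hRpos.le]
    refine (setIntegral_eq_of_subset_of_forall_sdiff_eq_zero measurableSet_Ioi
      Ioc_subset_Ioi_self fun r hr => ?_)
    have hr' : R < r := by
      by_contra! h
      exact hr.2 ⟨hr.1, h⟩
    simp [hG, gradient_eq_zero_of_notMem_tsupport (hout r hr'), hφ0 _ (hout r hr')]
  rw [hcut]
  set g : ℝ → ℝ := fun r => φ (r • θ)
  set dg : ℝ → ℝ := fun r => inner ℝ (gradient φ (r • θ)) θ
  have hdg : ∀ r, HasDerivAt g (dg r) r := by
    intro r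
    have h1 : HasGradientAt φ (gradient φ (r • θ)) (r • θ) :=
      (hφ.differentiable (by norm_num) _).hasGradientAt
    have h2 : HasDerivAt (fun r : ℝ => r • θ) ((1 : ℝ) • θ) r := (hasDerivAt_id r).smul_const θ
    refine (h1.hasFDerivAt.comp_hasDerivAt r h2).congr_deriv ?_
    simp [dg]
  have hgc : Continuous g := continuous_iff_continuousAt.2 fun r => (hdg r).continuousAt
  have hgrad := continuous_gradient hφ
  have hdgc : Continuous dg := by
    simp only [dg]
    fun_prop
  have hgr : g R = 0 := by
    have : ContinuousWithinAt g (Ioi R) R := hgc.continuousWithinAt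
    have h0 : Tendsto g (𝓝[>] R) (𝓝 0) :=
      tendsto_const_nhds.congr' (eventually_mem_nhdsWithin.mono fun r hr => (hφ0 _ (hout r hr)).symm)
    exact tendsto_nhds_unique this h0
  have hardy := hardy_interval n hRpos.le hgc.continuousOn hdgc.continuousOn (fun r _ => hdg r) hgr
  have hpc : Continuous fun r : ℝ => r • θ := by fun_prop
  have hGc : Continuous G := by
    have h1 : Continuous fun x : EuclideanSpace ℝ (Fin (n + 3)) =>
        deriv f (radial (n + 3) u x) := continuous_comp_norm hV'
    have h2 := h1.comp hpc
    have h3 := hgrad.comp hpc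
    have h4 := hφ.continuous.comp hpc
    exact (continuous_pow _).mul ((h3.norm.pow 2).sub (h2.mul (h4.pow 2)))
  -- On each ray only the radial component of the gradient is kept, and one-dimensional Hardy is
  -- applied to `r ↦ φ(rθ)`.
  have hle : ∫ r in 0..R, (r ^ (n + 2) * dg r ^ 2 - (((n : ℝ) + 1) / 2) ^ 2 * (r ^ n * g r ^ 2))
      ≤ ∫ r in 0..R, G r := by
    refine integral_le_integral_Icc hRpos.le (by fun_prop) hGc.continuousOn fun r hr => ?_
    have h1 : dg r ^ 2 ≤ ‖gradient φ (r • θ)‖ ^ 2 := by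
      have : |dg r| ≤ ‖gradient φ (r • θ)‖ * ‖θ‖ := abs_real_inner_le_norm _ _
      rw [hθ, mul_one] at this
      rw [← sq_abs]
      gcongr
    have h2 := hV r hr.1
    have h3 : radial (n + 3) u (r • θ) = u r := by simp [radial, hnorm r hr.1.le]
    simp only [hG, h3, show n + 3 - 1 = n + 2 from rfl]
    have h4 : r ^ (n + 2) * dg r ^ 2 ≤ r ^ (n + 2) * ‖gradient φ (r • θ)‖ ^ 2 :=
      mul_le_mul_of_nonneg_left h1 (pow_nonneg hr.1.le _)
    have h5 : r ^ n * g r ^ 2 * (r ^ 2 * deriv f (u r)) ≤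
        r ^ n * g r ^ 2 * (((n : ℝ) + 1) / 2) ^ 2 := by
      refine mul_le_mul_of_nonneg_left (h2.trans_eq ?_)
        (mul_nonneg (pow_nonneg hr.1.le _) (sq_nonneg _))
      push_cast
      ring
    have h6 : r ^ (n + 2) * (deriv f (u r) * g r ^ 2) = r ^ n * g r ^ 2 * (r ^ 2 * deriv f (u r)) := by
      ring
    rw [mul_sub, h6]
    linarith
  rw [intervalIntegral.integral_sub (Continuous.intervalIntegrable (by fun_prop) _ _)
    (Continuous.intervalIntegrable (by fun_prop) _ _)] at hle
  linarith

/-! ### Radial test functions -/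

/-- The gradient of a radial function. -/
lemma hasGradientAt_radial {N : ℕ} {χ dχ : ℝ → ℝ} (hχ : ∀ r > 0, HasDerivAt χ (dχ r) r)
    (hχ0 : HasDerivWithinAt χ 0 (Ici 0) 0) (x : EuclideanSpace ℝ (Fin N)) :
    HasGradientAt (radial N χ) ((dχ ‖x‖ / ‖x‖) • x) x := by
  rcases eq_or_ne x 0 with rfl | hx
  · rw [smul_zero, hasGradientAt_iff_isLittleO]
    have h1 : (fun r => χ r - χ 0) =o[𝓝[Ici 0] 0] fun r : ℝ => r := by
      have := hasDerivWithinAt_iff_isLittleO.1 hχ0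
      simpa using this
    have h2 : Tendsto (fun y : EuclideanSpace ℝ (Fin N) => ‖y‖) (𝓝 0) (𝓝[Ici 0] 0) := by
      refine tendsto_nhdsWithin_iff.2 ⟨?_, .of_forall fun y => norm_nonneg y⟩
      simpa using continuous_norm.tendsto (0 : EuclideanSpace ℝ (Fin N))
    have h3 := h1.comp_tendsto h2
    have h4 := Asymptotics.isLittleO_norm_right.1 h3
    simpa [radial, Function.comp_def] using h4
  · have hx' : 0 < ‖x‖ := norm_pos_iff.2 hx
    have h1 : HasFDerivAt (fun y : EuclideanSpace ℝ (Fin N) => ‖y‖) (‖x‖⁻¹ • innerSL ℝ x) x := by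
      have h2 := ((hasStrictFDerivAt_norm_sq x).hasFDerivAt).sqrt (by positivity)
      simp only [Real.sqrt_sq (norm_nonneg _)] at h2
      refine h2.congr_fderiv ?_
      ext y
      simp
      field_simp
    have h2 := (hχ ‖x‖ hx').comp_hasFDerivAt x h1
    rw [hasGradientAt_iff_hasFDerivAt]
    refine h2.congr_fderiv ?_
    ext y
    simp
    ring

/-- The gradient has norm `|dχ ‖x‖|` away from the origin, so `dχ 0 = 0` is what makes it continuous
there. -/
lemma contDiff_radial {N : ℕ} {χ dχ : ℝ → ℝ} (hχ : ∀ r > 0, HasDerivAt χ (dχ r) r)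
    (hχ0 : HasDerivWithinAt χ 0 (Ici 0) 0) (hd : ContinuousOn dχ (Ici 0)) (hd0 : dχ 0 = 0) :
    ContDiff ℝ 1 (radial N χ) := by
  have hg := hasGradientAt_radial (N := N) hχ hχ0
  rw [contDiff_one_iff_fderiv]
  refine ⟨fun x => (hg x).differentiableAt, ?_⟩
  have h1 : fderiv ℝ (radial N χ) = fun x =>
      InnerProductSpace.toDual ℝ (EuclideanSpace ℝ (Fin N)) ((dχ ‖x‖ / ‖x‖) • x) :=
    funext fun x => (hg x).hasFDerivAt.fderiv
  rw [h1]
  refine (InnerProductSpace.toDual ℝ _).continuous.comp ?_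
  have hdc : Continuous fun x : EuclideanSpace ℝ (Fin N) => dχ ‖x‖ := continuous_comp_norm hd
  rw [continuous_iff_continuousAt]
  intro x
  rcases eq_or_ne x 0 with rfl | hx
  · rw [ContinuousAt, smul_zero]
    refine squeeze_zero_norm (a := fun x : EuclideanSpace ℝ (Fin N) => |dχ ‖x‖|) (fun y => ?_) ?_
    · rw [norm_smul, norm_div, norm_norm, Real.norm_eq_abs]
      rcases eq_or_ne y 0 with rfl | hy
      · simp
      · rw [div_mul_cancel₀ _ (norm_ne_zero_iff.2 hy)]
    · have := hdc.abs.tendsto 0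
      simpa [hd0] using this
  · exact (hdc.continuousAt.div continuous_norm.continuousAt (norm_ne_zero_iff.2 hx)).smul
      continuousAt_id

/-- The stability inequality for radial `C¹` test functions. -/
lemma IsStable.radial_test {N : ℕ} (hN : 1 ≤ N) {f u : ℝ → ℝ} (hst : IsStable f (radial N u))
    {χ dχ : ℝ → ℝ} (hχ : ∀ r > 0, HasDerivAt χ (dχ r) r)
    (hχ0 : HasDerivWithinAt χ 0 (Ici 0) 0) (hd : ContinuousOn dχ (Ici 0)) (hd0 : dχ 0 = 0)
    {R : ℝ} (hR : 0 ≤ R) (hsupp : ∀ r, R < r → χ r = 0) :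
    0 ≤ ∫ r in 0..R, r ^ (N - 1) * (dχ r ^ 2 - deriv f (u r) * χ r ^ 2) := by
  have : Nonempty (Fin N) := ⟨⟨0, hN⟩⟩
  have hg := hasGradientAt_radial (N := N) hχ hχ0
  have h0 := hst (radial N χ) (contDiff_radial hχ hχ0 hd hd0)
    (HasCompactSupport.intro (isCompact_closedBall 0 R) fun x hx => by
      rw [mem_closedBall_zero_iff, not_le] at hx
      exact hsupp _ hx)
  have hgn : ∀ x : EuclideanSpace ℝ (Fin N), ‖gradient (radial N χ) x‖ ^ 2 = dχ ‖x‖ ^ 2 := by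
    intro x
    rw [(hg x).gradient, norm_smul, norm_div, norm_norm]
    rcases eq_or_ne x 0 with rfl | hx
    · simp [hd0]
    · rw [div_mul_cancel₀ _ (norm_ne_zero_iff.2 hx), Real.norm_eq_abs, sq_abs]
  simp only [hgn, radial] at h0
  rw [integral_fun_norm_addHaar volume fun r => dχ r ^ 2 - deriv f (u r) * χ r ^ 2] at h0
  simp only [finrank_euclideanSpace_fin, smul_eq_mul, nsmul_eq_mul] at h0
  have hNpos : (0 : ℝ) < N := by exact_mod_cast hN
  have hvol : 0 < (volume : Measure (EuclideanSpace ℝ (Fin N))).real (Metric.ball 0 1) :=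
    ENNReal.toReal_pos (Metric.measure_ball_pos _ _ one_pos).ne' measure_ball_lt_top.ne
  have h1 := nonneg_of_mul_nonneg_right (nonneg_of_mul_nonneg_right h0 hNpos) hvol
  refine h1.trans_eq ?_
  rw [intervalIntegral.integral_of_le hR]
  refine setIntegral_eq_of_subset_of_forall_sdiff_eq_zero measurableSet_Ioi
    Ioc_subset_Ioi_self fun r hr => ?_
  have hr' : R < r := by
    by_contra! h
    exact hr.2 ⟨hr.1, h⟩
  have hd : dχ r = 0 := by
    have h3 : χ =ᶠ[𝓝 r] fun _ => 0 := by
      filter_upwards [Ioi_mem_nhds hr'] with s hs using hsupp s hs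
    exact (hχ r (hR.trans_lt hr')).unique ((hasDerivAt_const r (0 : ℝ)).congr_of_eventuallyEq h3)
  simp [hd, hsupp r hr']

/-! ### Truncation -/

/-- A `C¹` truncation: zero below `δ` and within `2δ` of the identity above it. -/
noncomputable def trunc (δ s : ℝ) : ℝ := if s ≤ δ then 0 else (s - δ) ^ 2 / s

/-- The derivative of `trunc δ`. -/
noncomputable def truncDeriv (δ s : ℝ) : ℝ := if s ≤ δ then 0 else 1 - δ ^ 2 / s ^ 2

lemma hasDerivAt_trunc {δ : ℝ} (hδ : 0 < δ) (s : ℝ) :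
    HasDerivAt (trunc δ) (truncDeriv δ s) s := by
  have hR : ∀ s ≠ 0, HasDerivAt (fun s => (s - δ) ^ 2 / s) (1 - δ ^ 2 / s ^ 2) s := by
    intro s hs
    have := (((hasDerivAt_id s).sub_const δ).pow 2).div (hasDerivAt_id s) hs
    refine this.congr_deriv ?_
    simp
    field_simp
    ring
  rcases lt_trichotomy s δ with h | rfl | h
  · rw [truncDeriv, if_pos h.le]
    refine (hasDerivAt_const s (0 : ℝ)).congr_of_eventuallyEq ?_
    filter_upwards [Iio_mem_nhds h] with x hx
    rw [trunc, if_pos hx.le]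
  · rw [truncDeriv, if_pos le_rfl]
    have h1 : HasDerivWithinAt (trunc s) 0 (Iic s) s :=
      (hasDerivWithinAt_const s _ (0 : ℝ)).congr (fun x hx => if_pos hx) (if_pos le_rfl)
    have h2 : HasDerivWithinAt (trunc s) 0 (Ici s) s := by
      have := (hR s hδ.ne').hasDerivWithinAt (s := Ici s)
      rw [div_self (by positivity), sub_self] at this
      refine this.congr (fun x hx => ?_) (by simp [trunc])
      rcases (mem_Ici.1 hx).eq_or_lt with rfl | hlt
      · simp [trunc]
      · rw [trunc, if_neg (not_le.2 hlt)]
    have := h1.union h2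
    rwa [Iic_union_Ici, hasDerivWithinAt_univ] at this
  · rw [truncDeriv, if_neg (not_le.2 h)]
    refine (hR s (hδ.trans h).ne').congr_of_eventuallyEq ?_
    filter_upwards [Ioi_mem_nhds h] with x hx
    rw [trunc, if_neg (not_le.2 hx)]

lemma continuous_truncDeriv {δ : ℝ} (hδ : 0 < δ) : Continuous (truncDeriv δ) := by
  have : truncDeriv δ = fun s => 1 - δ ^ 2 / (max s δ) ^ 2 := by
    funext s
    rw [truncDeriv]
    split_ifs with h
    · rw [max_eq_right h, div_self (by positivity), sub_self]
    · rw [max_eq_left (not_le.1 h).le]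
  rw [this]
  refine continuous_const.sub (continuous_const.div (by fun_prop) fun s => ?_)
  have : 0 < max s δ := lt_max_of_lt_right hδ
  positivity

lemma abs_truncDeriv_le {δ : ℝ} (hδ : 0 < δ) (s : ℝ) : |truncDeriv δ s| ≤ 1 := by
  rw [truncDeriv]
  split_ifs with h
  · simp
  · have hs : δ < s := not_le.1 h
    have h1 : δ ^ 2 / s ^ 2 ≤ 1 := by
      rw [div_le_one (by have := hδ.trans hs; positivity)]
      gcongr
    have h2 : 0 ≤ δ ^ 2 / s ^ 2 := by positivity
    rw [abs_le]
    constructor <;> linarith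

lemma abs_sq_sub_trunc_sq_le {δ s : ℝ} (hδ : 0 < δ) (hs : 0 ≤ s) :
    |s ^ 2 - trunc δ s ^ 2| ≤ 4 * δ * s := by
  have h1 : 0 ≤ trunc δ s ∧ trunc δ s ≤ s ∧ s - 2 * δ ≤ trunc δ s := by
    rw [trunc]
    split_ifs with h
    · exact ⟨le_rfl, hs, by linarith⟩
    · have hs : 0 < s := hδ.trans (not_le.1 h)
      refine ⟨by positivity, ?_, ?_⟩
      · rw [div_le_iff₀ hs]; nlinarith
      · rw [le_div_iff₀ hs]; nlinarith [sq_nonneg δ]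
  obtain ⟨h1, h2, h3⟩ := h1
  rw [abs_of_nonneg (by nlinarith)]
  nlinarith

/-- The stability inequality for radial test functions vanishing on a sphere. -/
lemma IsStable.radial_ineq {N : ℕ} (hN : 1 ≤ N) {f u : ℝ → ℝ} (hf : Continuous (deriv f))
    (hu : ContinuousOn u (Ici 0)) (hst : IsStable f (radial N u))
    {η dη : ℝ → ℝ} {R : ℝ} (hR : 0 < R) (hη : ContinuousOn η (Icc 0 R))
    (hdη : ContinuousOn dη (Icc 0 R)) (hd : ∀ r ∈ Ioo 0 R, HasDerivAt η (dη r) r)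
    (hd0 : dη 0 = 0) (hpos : ∀ r ∈ Ico 0 R, 0 ≤ η r) (hηR : η R = 0) :
    ∫ r in 0..R, r ^ (N - 1) * (deriv f (u r) * η r ^ 2) ≤
      ∫ r in 0..R, r ^ (N - 1) * dη r ^ 2 := by
  have hV : ContinuousOn (fun r => deriv f (u r)) (Icc 0 R) :=
    (hf.comp_continuousOn hu).mono Icc_subset_Ici_self
  have hpow : ContinuousOn (fun r : ℝ => r ^ (N - 1)) (Icc 0 R) := by fun_prop
  have hI1 : ContinuousOn (fun r => r ^ (N - 1) * (deriv f (u r) * η r ^ 2)) (Icc 0 R) :=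
    hpow.mul (hV.mul (hη.pow 2))
  have hI2 : ContinuousOn (fun r => r ^ (N - 1) * dη r ^ 2) (Icc 0 R) := hpow.mul (hdη.pow 2)
  have hI3 : ContinuousOn (fun r => r ^ (N - 1) * (|deriv f (u r)| * (4 * η r))) (Icc 0 R) :=
    hpow.mul (hV.abs.mul (continuousOn_const.mul hη))
  -- Extended by zero, `η` may have a corner at `R`. Since `η ≤ δ` near `R`, its truncation vanishes
  -- there and is an admissible `C¹` test function. Truncation does not increase `η'²` and changes
  -- `η²` by at most `4δη`, an error that disappears as `δ → 0`.
  have key : ∀ δ > 0, ∫ r in 0..R, r ^ (N - 1) * (deriv f (u r) * η r ^ 2) ≤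
      (∫ r in 0..R, r ^ (N - 1) * dη r ^ 2) +
        δ * ∫ r in 0..R, r ^ (N - 1) * (|deriv f (u r)| * (4 * η r)) := by
    intro δ hδ
    set η' : ℝ → ℝ := fun r => if r < R then η r else 0 with hη'
    set χ : ℝ → ℝ := fun r => trunc δ (η' r) with hχdef
    set dχ : ℝ → ℝ := fun r => if r < R then truncDeriv δ (η r) * dη r else 0 with hdχdef
    have hnear : ∃ ρ, 0 < ρ ∧ ρ < R ∧ ∀ r ∈ Ioc ρ R, η r ≤ δ := by
      have h1 : ∀ᶠ r in 𝓝[Icc 0 R] R, η r < δ :=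
        (hη R ⟨hR.le, le_rfl⟩).eventually (gt_mem_nhds (by rwa [hηR]))
      have h2 : ∀ᶠ r in 𝓝[≤] R, η r < δ := by
        rwa [nhdsWithin_Icc_eq_nhdsLE hR] at h1
      obtain ⟨l, hl, hlR⟩ := (mem_nhdsLE_iff_exists_Ioc_subset' hR).1 h2
      refine ⟨max l (R / 2), by positivity, max_lt hl (by linarith), fun r hr => ?_⟩
      exact (hlR ⟨(le_max_left _ _).trans_lt hr.1, hr.2⟩ : η r < δ).le
    obtain ⟨ρ, hρ0, hρR, hρ⟩ := hnear
    have hχ0 : ∀ r > ρ, χ r = 0 := by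
      intro r hr
      simp only [hχdef, hη', trunc]
      rw [if_pos]
      split_ifs with h
      · exact hρ r ⟨hr, h.le⟩
      · exact hδ.le
    have hdχ0 : ∀ r > ρ, dχ r = 0 := by
      intro r hr
      simp only [hdχdef, truncDeriv]
      split_ifs with h h' <;> try simp
      exact absurd (hρ r ⟨hr, h.le⟩) h'
    have hχlt : ∀ r < R, χ r = trunc δ (η r) := fun r hr => by simp only [hχdef, hη', if_pos hr]
    have hdχlt : ∀ r < R, dχ r = truncDeriv δ (η r) * dη r := fun r hr => by
      simp only [hdχdef, if_pos hr]
    have hχd : ∀ r > 0, HasDerivAt χ (dχ r) r := by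
      intro r hr
      rcases lt_or_ge r R with h | h
      · rw [hdχlt r h]
        refine ((hasDerivAt_trunc hδ (η r)).comp r (hd r ⟨hr, h⟩)).congr_of_eventuallyEq ?_
        filter_upwards [Iio_mem_nhds h] with s hs using hχlt s hs
      · rw [hdχ0 r (hρR.trans_le h)]
        refine (hasDerivAt_const r (0 : ℝ)).congr_of_eventuallyEq ?_
        filter_upwards [Ioi_mem_nhds (hρR.trans_le h)] with s hs using hχ0 s hs
    have hdχc : ContinuousOn dχ (Ici 0) := by
      intro r hr
      rcases lt_or_ge r R with h | h
      · have h1 : ContinuousWithinAt (fun r => truncDeriv δ (η r) * dη r) (Ici 0) r := by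
          have hmem : r ∈ Icc 0 R := ⟨hr, h.le⟩
          have h2 : ContinuousWithinAt (fun r => truncDeriv δ (η r) * dη r) (Icc 0 R) r :=
            ((continuous_truncDeriv hδ).continuousAt.comp_continuousWithinAt (hη r hmem)).mul
              (hdη r hmem)
          refine h2.mono_of_mem_nhdsWithin ?_
          rw [← Ici_inter_Iic]
          exact inter_mem self_mem_nhdsWithin (mem_nhdsWithin_of_mem_nhds (Iic_mem_nhds h))
        refine h1.congr_of_eventuallyEq ?_ (hdχlt r h)
        filter_upwards [mem_nhdsWithin_of_mem_nhds (Iio_mem_nhds h)] with s hs using hdχlt s hs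
      · have h1 : ContinuousAt dχ r := by
          refine (continuousAt_const (y := (0 : ℝ))).congr ?_
          filter_upwards [Ioi_mem_nhds (hρR.trans_le h)] with s hs using (hdχ0 s hs).symm
        exact h1.continuousWithinAt
    have hdχ00 : dχ 0 = 0 := by rw [hdχlt 0 hR, hd0, mul_zero]
    have hχc0 : ContinuousWithinAt χ (Ioi 0) 0 := by
      have h2 : ContinuousWithinAt η (Ioi 0) 0 := by
        refine (hη 0 ⟨le_rfl, hR.le⟩).mono_of_mem_nhdsWithin ?_
        exact Icc_mem_nhdsGT hR
      refine ((hasDerivAt_trunc hδ (η 0)).continuousAt.comp_continuousWithinAt h2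
        ).congr_of_eventuallyEq ?_ (hχlt 0 hR)
      filter_upwards [mem_nhdsWithin_of_mem_nhds (Iio_mem_nhds hR)] with s hs using hχlt s hs
    have hχd0 : HasDerivWithinAt χ 0 (Ici 0) 0 := by
      refine hasDerivWithinAt_Ici_of_tendsto_deriv (s := Ioi 0)
        (fun r hr => (hχd r hr).differentiableAt.differentiableWithinAt) hχc0
        self_mem_nhdsWithin ?_
      have h1 : Tendsto dχ (𝓝[>] 0) (𝓝 0) := by
        have := (hdχc 0 self_mem_Ici).mono Ioi_subset_Ici_self
        rwa [ContinuousWithinAt, hdχ00] at this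
      refine h1.congr' ?_
      filter_upwards [self_mem_nhdsWithin] with r hr using (hχd r hr).deriv.symm
    have htest := hst.radial_test hN hχd hχd0 hdχc hdχ00 hR.le
      (fun r hr => hχ0 r (hρR.trans hr))
    have hdχI : ContinuousOn dχ (Icc 0 R) := hdχc.mono Icc_subset_Ici_self
    have hχI : ContinuousOn χ (Icc 0 R) := fun r hr => by
      rcases hr.1.eq_or_lt with rfl | h
      · refine (continuousWithinAt_Ioi_iff_Ici.1 hχc0).mono Icc_subset_Ici_self
      · exact (hχd r h).continuousAt.continuousWithinAt
    have hmono := integral_le_integral_Icc hR.le hI1 (g := fun r =>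
        r ^ (N - 1) * (deriv f (u r) * η r ^ 2)) (h := fun r => r ^ (N - 1) * dη r ^ 2
          + δ * (r ^ (N - 1) * (|deriv f (u r)| * (4 * η r)))
          - r ^ (N - 1) * (dχ r ^ 2 - deriv f (u r) * χ r ^ 2))
      ((hI2.add (continuousOn_const.mul hI3)).sub
        (hpow.mul ((hdχI.pow 2).sub (hV.mul (hχI.pow 2))))) (fun r hr => by
      have hp : 0 ≤ r ^ (N - 1) := pow_nonneg hr.1.le _
      have h1 : dχ r ^ 2 ≤ dη r ^ 2 := by
        rw [hdχlt r hr.2, mul_pow]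
        have h3 : truncDeriv δ (η r) ^ 2 ≤ 1 := (sq_le_one_iff_abs_le_one _).2 (abs_truncDeriv_le hδ _)
        nlinarith [sq_nonneg (dη r)]
      have h2 := abs_sq_sub_trunc_sq_le hδ (hpos r ⟨hr.1.le, hr.2⟩)
      rw [← hχlt r hr.2] at h2
      have h3 : deriv f (u r) * (η r ^ 2 - χ r ^ 2) ≤ |deriv f (u r)| * (4 * δ * η r) := by
        refine (le_abs_self _).trans ?_
        rw [abs_mul]
        gcongr
      have h4 : deriv f (u r) * η r ^ 2 ≤ dη r ^ 2 + δ * (|deriv f (u r)| * (4 * η r))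
          - (dχ r ^ 2 - deriv f (u r) * χ r ^ 2) := by linarith
      calc _ ≤ _ := mul_le_mul_of_nonneg_left h4 hp
        _ = _ := by ring)
    have hi2 := hI2.intervalIntegrable_of_Icc (μ := volume) hR.le
    have hi3 := hI3.intervalIntegrable_of_Icc (μ := volume) hR.le
    have hi4 : IntervalIntegrable (fun r => r ^ (N - 1) * (dχ r ^ 2 - deriv f (u r) * χ r ^ 2))
        volume 0 R :=
      (hpow.mul ((hdχI.pow 2).sub (hV.mul (hχI.pow 2)))).intervalIntegrable_of_Icc hR.le
    rw [intervalIntegral.integral_sub (hi2.add (hi3.const_mul δ)) hi4,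
      intervalIntegral.integral_add hi2 (hi3.const_mul δ),
      intervalIntegral.integral_const_mul] at hmono
    linarith
  set J := ∫ r in 0..R, r ^ (N - 1) * (|deriv f (u r)| * (4 * η r)) with hJ
  have hlim : Tendsto (fun δ : ℝ => (∫ r in 0..R, r ^ (N - 1) * dη r ^ 2) + δ * J) (𝓝[>] 0)
      (𝓝 ((∫ r in 0..R, r ^ (N - 1) * dη r ^ 2) + 0 * J)) := by
    refine Tendsto.mono_left ?_ nhdsWithin_le_nhds
    exact Continuous.tendsto (by fun_prop) 0
  rw [zero_mul, add_zero] at hlim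
  exact ge_of_tendsto hlim (eventually_mem_nhdsWithin.mono fun δ hδ => key δ hδ)

/-! ### Positivity and ordering of solutions -/

lemma continuous_integrand {N : ℕ} {f u : ℝ → ℝ} (hf : Continuous (deriv f))
    (hu : ContinuousOn u (Ici 0)) {φ : EuclideanSpace ℝ (Fin N) → ℝ} (hφ : ContDiff ℝ 1 φ) :
    Continuous fun x => ‖gradient φ x‖ ^ 2 - deriv f (radial N u x) * φ x ^ 2 := by
  have h1 : Continuous fun x : EuclideanSpace ℝ (Fin N) => deriv f (radial N u x) :=
    continuous_comp_norm (hf.comp_continuousOn hu)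
  exact ((continuous_gradient hφ).norm.pow 2).sub (h1.mul (hφ.continuous.pow 2))

lemma integrable_integrand {N : ℕ} {f u : ℝ → ℝ} (hf : Continuous (deriv f))
    (hu : ContinuousOn u (Ici 0)) {φ : EuclideanSpace ℝ (Fin N) → ℝ} (hφ : ContDiff ℝ 1 φ)
    (hs : HasCompactSupport φ) :
    Integrable fun x => ‖gradient φ x‖ ^ 2 - deriv f (radial N u x) * φ x ^ 2 := by
  refine (continuous_integrand hf hu hφ).integrable_of_hasCompactSupport ?_
  refine HasCompactSupport.intro hs.isCompact fun x hx => ?_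
  simp [gradient_eq_zero_of_notMem_tsupport hx, image_eq_zero_of_notMem_tsupport hx]

lemma IsStable.mono {N : ℕ} {f u v : ℝ → ℝ} (hf : Continuous (deriv f))
    (hu : ContinuousOn u (Ici 0)) (hv : ContinuousOn v (Ici 0)) (hst : IsStable f (radial N u))
    (hle : ∀ r ≥ 0, deriv f (v r) ≤ deriv f (u r)) : IsStable f (radial N v) := by
  intro φ hφ hs
  refine (hst φ hφ hs).trans (integral_mono (integrable_integrand hf hu hφ hs)
    (integrable_integrand hf hv hφ hs) fun x => ?_)
  have := mul_le_mul_of_nonneg_right (hle ‖x‖ (norm_nonneg x)) (sq_nonneg (φ x))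
  simp only [radial]
  linarith

/-- Divergence form of the radial Laplacian, used for `u`, for differences of solutions and for
`F(u)`. -/
lemma hasDerivAt_pow_mul {N : ℕ} (hN : 1 ≤ N) {dw g : ℝ → ℝ} {r : ℝ} (hr : 0 < r)
    (h : HasDerivAt dw (-(((N : ℝ) - 1) / r * dw r) - g r) r) :
    HasDerivAt (fun r => r ^ (N - 1) * dw r) (-(r ^ (N - 1) * g r)) r := by
  obtain ⟨n, rfl⟩ : ∃ n, N = n + 1 := ⟨N - 1, by omega⟩
  have := (hasDerivAt_pow n r).mul h
  refine this.congr_deriv ?_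
  rcases n with _ | n
  · simp
  · simp only [Nat.add_sub_cancel]
    push_cast
    field_simp
    ring

/-- Green's identity for radial functions vanishing on a sphere. -/
lemma green_identity {N : ℕ} (hN : 2 ≤ N) {w dw g : ℝ → ℝ} {R : ℝ} (hR : 0 ≤ R)
    (hw : ContinuousOn w (Icc 0 R)) (hdw : ContinuousOn dw (Icc 0 R))
    (hg : ContinuousOn g (Icc 0 R)) (hd : ∀ r ∈ Ioo 0 R, HasDerivAt w (dw r) r)
    (hd' : ∀ r ∈ Ioo 0 R, HasDerivAt dw (-(((N : ℝ) - 1) / r * dw r) - g r) r) (hwR : w R = 0) :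
    ∫ r in 0..R, r ^ (N - 1) * dw r ^ 2 = ∫ r in 0..R, r ^ (N - 1) * (g r * w r) := by
  have hpow : ContinuousOn (fun r : ℝ => r ^ (N - 1)) (Icc 0 R) := by fun_prop
  have h1 : ContinuousOn (fun r => r ^ (N - 1) * dw r ^ 2) (Icc 0 R) := hpow.mul (hdw.pow 2)
  have h2 : ContinuousOn (fun r => r ^ (N - 1) * (g r * w r)) (Icc 0 R) := hpow.mul (hg.mul hw)
  have h3 := integral_eq_sub_of_hasDerivAt_Ioo (g := fun r => r ^ (N - 1) * dw r * w r)
    (g' := fun r => r ^ (N - 1) * dw r ^ 2 - r ^ (N - 1) * (g r * w r)) hR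
    ((hpow.mul hdw).mul hw) (fun r hr => by
      refine ((hasDerivAt_pow_mul (by omega) hr.1 (hd' r hr)).mul (hd r hr)).congr_deriv ?_
      ring) (h1.sub h2)
  rw [intervalIntegral.integral_sub (h1.intervalIntegrable_of_Icc hR)
    (h2.intervalIntegrable_of_Icc hR), hwR, zero_pow (by omega)] at h3
  linarith

namespace IsProfile

variable {N : ℕ} {f : ℝ → ℝ} {α : ℝ} {u du : ℝ → ℝ}

lemma du_neg (hN : 2 ≤ N) (hf : IsAdmissible f) (h : IsProfile N f α u du) {r : ℝ} (hr : 0 < r)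
    (hpos : ∀ s ∈ Ioo 0 r, 0 < u s) : du r < 0 := by
  have hanti : StrictAntiOn (fun r => r ^ (N - 1) * du r) (Icc 0 r) := by
    refine strictAntiOn_of_deriv_neg (convex_Icc 0 r)
      ((Continuous.continuousOn (by fun_prop)).mul (h.dcont.mono Icc_subset_Ici_self))
      fun s hs => ?_
    rw [interior_Icc] at hs
    rw [(hasDerivAt_pow_mul (g := fun r => f (u r)) (by omega) hs.1 (h.hasDerivAt' s hs.1)).deriv]
    exact neg_neg_of_pos (mul_pos (pow_pos hs.1 _) (hf.pos _ (hpos s hs)))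
  have h1 := hanti ⟨le_rfl, hr.le⟩ ⟨hr.le, le_rfl⟩ hr
  simp only [h.dinit, mul_zero] at h1
  by_contra! h2
  exact absurd (mul_nonneg (pow_nonneg hr.le (N - 1)) h2) (not_le.2 h1)

lemma strictAntiOn (hN : 2 ≤ N) (hf : IsAdmissible f) (h : IsProfile N f α u du) {R : ℝ}
    (hpos : ∀ s ∈ Ioo 0 R, 0 < u s) : StrictAntiOn u (Icc 0 R) := by
  refine strictAntiOn_of_deriv_neg (convex_Icc 0 R) (h.cont.mono Icc_subset_Ici_self)
    fun s hs => ?_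
  rw [interior_Icc] at hs
  rw [(h.hasDerivAt s hs.1).deriv]
  exact h.du_neg hN hf hs.1 fun x hx => hpos x ⟨hx.1, hx.2.trans hs.2⟩

/-- A solution which satisfies the stability inequality, tested with itself, up to its first zero
has no zero. -/
lemma pos_of_test (hN : 2 ≤ N) (hf : IsAdmissible f) (hα : 0 < α) (h : IsProfile N f α u du)
    (htest : ∀ R > 0, (∀ r ∈ Ico 0 R, 0 < u r) → u R = 0 →
      ∫ r in 0..R, r ^ (N - 1) * (deriv f (u r) * u r ^ 2) ≤
        ∫ r in 0..R, r ^ (N - 1) * du r ^ 2) {r : ℝ} (hr : 0 ≤ r) : 0 < u r := by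
  by_contra! hneg
  obtain ⟨R, hR, -, huR, hpos⟩ := exists_first_zero hr (h.cont.mono Icc_subset_Ici_self)
    (by rwa [h.init]) hneg
  have hu : ContinuousOn u (Icc 0 R) := h.cont.mono Icc_subset_Ici_self
  have hfu : ContinuousOn (fun r => f (u r)) (Icc 0 R) := hf.continuous.comp_continuousOn hu
  have hV : ContinuousOn (fun r => deriv f (u r)) (Icc 0 R) :=
    hf.continuous_deriv.comp_continuousOn hu
  have hpow : ContinuousOn (fun r : ℝ => r ^ (N - 1)) (Icc 0 R) := by fun_prop
  have h1 := htest R hR hpos huR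
  -- Green's identity turns `∫ r^(N-1) u'²` into `∫ r^(N-1) f(u) u`, which is strictly less than `∫
  -- r^(N-1) f'(u) u²` because `f(s) < s f'(s)` for `s > 0`.
  rw [green_identity hN hR.le hu (h.dcont.mono Icc_subset_Ici_self) hfu
    (fun r hr => h.hasDerivAt r hr.1) (fun r hr => h.hasDerivAt' r hr.1) huR] at h1
  refine absurd (integral_lt_integral_Icc hR (hpow.mul (hfu.mul hu))
    (hpow.mul (hV.mul (hu.pow 2))) fun r hr => ?_) (not_lt.2 h1)
  have hur := hpos r ⟨hr.1.le, hr.2⟩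
  have h2 := hf.lt_deriv_mul hur
  refine mul_lt_mul_of_pos_left ?_ (pow_pos hr.1 _)
  change f (u r) * u r < deriv f (u r) * u r ^ 2
  nlinarith

lemma pos_of_isStable (hN : 2 ≤ N) (hf : IsAdmissible f) (hα : 0 < α) (h : IsProfile N f α u du)
    (hst : IsStable f (radial N u)) {r : ℝ} (hr : 0 ≤ r) : 0 < u r :=
  h.pos_of_test hN hf hα (fun R hR hpos huR =>
    hst.radial_ineq (by omega) hf.continuous_deriv h.cont hR (h.cont.mono Icc_subset_Ici_self)
      (h.dcont.mono Icc_subset_Ici_self) (fun r hr => h.hasDerivAt r hr.1) h.dinit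
      (fun r hr => (hpos r hr).le) huR) hr

/-- A stable solution stays above a solution with smaller initial value while the latter is
positive. -/
lemma lt_of_isStable_of_pos (hN : 2 ≤ N) (hf : IsAdmissible f) (h : IsProfile N f α u du)
    (hst : IsStable f (radial N u)) {β : ℝ} {v dv : ℝ → ℝ} (hβα : β < α)
    (hv : IsProfile N f β v dv) {R : ℝ} (hR : 0 ≤ R) (hpos : ∀ r ∈ Icc 0 R, 0 < v r) :
    v R < u R := by
  by_contra! hle
  obtain ⟨c, hc, hcR, hwc, hwpos⟩ := exists_first_zero (d := fun r => u r - v r) hR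
    ((h.cont.sub hv.cont).mono Icc_subset_Ici_self)
    (by rw [h.init, hv.init]; linarith) (by linarith)
  have hu : ContinuousOn u (Icc 0 c) := h.cont.mono Icc_subset_Ici_self
  have hv' : ContinuousOn v (Icc 0 c) := hv.cont.mono Icc_subset_Ici_self
  have hw : ContinuousOn (fun r => u r - v r) (Icc 0 c) := hu.sub hv'
  have hdw : ContinuousOn (fun r => du r - dv r) (Icc 0 c) :=
    (h.dcont.sub hv.dcont).mono Icc_subset_Ici_self
  have hg : ContinuousOn (fun r => f (u r) - f (v r)) (Icc 0 c) :=
    (hf.continuous.comp_continuousOn hu).sub (hf.continuous.comp_continuousOn hv')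
  have hV : ContinuousOn (fun r => deriv f (u r)) (Icc 0 c) :=
    hf.continuous_deriv.comp_continuousOn hu
  have hpow : ContinuousOn (fun r : ℝ => r ^ (N - 1)) (Icc 0 c) := by fun_prop
  have hd : ∀ r ∈ Ioo 0 c, HasDerivAt (fun r => u r - v r) (du r - dv r) r := fun r hr =>
    (h.hasDerivAt r hr.1).sub (hv.hasDerivAt r hr.1)
  have h1 := hst.radial_ineq (by omega) hf.continuous_deriv h.cont hc hw hdw hd
    (by rw [h.dinit, hv.dinit, sub_self]) (fun r hr => (hwpos r hr).le) hwc
  -- The same argument for `w = u - v`: convexity gives `(f(u) - f(v)) w < f'(u) w²`. It needs `v`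
  -- nonnegative, where `f'` increases.
  rw [green_identity hN hc.le hw hdw hg hd (fun r hr => by
    refine ((h.hasDerivAt' r hr.1).sub (hv.hasDerivAt' r hr.1)).congr_deriv ?_
    ring) hwc] at h1
  refine absurd (integral_lt_integral_Icc hc (hpow.mul (hg.mul hw))
    (hpow.mul (hV.mul (hw.pow 2))) fun r hr => ?_) (not_lt.2 h1)
  have hwr := hwpos r ⟨hr.1.le, hr.2⟩
  have hvr := hpos r ⟨hr.1.le, hr.2.le.trans hcR⟩
  have h2 := (hf.sub_bounds hvr.le (sub_pos.1 hwr)).2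
  refine mul_lt_mul_of_pos_left ?_ (pow_pos hr.1 _)
  have := mul_lt_mul_of_pos_right h2 hwr
  change (f (u r) - f (v r)) * (u r - v r) < deriv f (u r) * (u r - v r) ^ 2
  linarith

/-- Up to a first zero `R` of `v` one has `0 < v < u`, so `r^(N-1)(u'v - v'u)` has derivative
`r^(N-1)(f(v)u - f(u)v) < 0` and is negative at `R`. But its value there is `-R^(N-1) v'(R) u(R) >
0`. -/
lemma pos_of_isStable_of_lt (hN : 2 ≤ N) (hf : IsAdmissible f) (hα : 0 < α)
    (h : IsProfile N f α u du) (hst : IsStable f (radial N u)) {β : ℝ} {v dv : ℝ → ℝ}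
    (hβ : 0 < β) (hβα : β < α) (hv : IsProfile N f β v dv) {r : ℝ} (hr : 0 ≤ r) : 0 < v r := by
  by_contra! hneg
  obtain ⟨R, hR, -, hvR, hpos⟩ := exists_first_zero hr (hv.cont.mono Icc_subset_Ici_self)
    (by rwa [hv.init]) hneg
  have hlt : ∀ r ∈ Ico 0 R, v r < u r := fun r hr =>
    h.lt_of_isStable_of_pos hN hf hst hβα hv hr.1 fun s hs => hpos s ⟨hs.1, hs.2.trans_lt hr.2⟩
  have hanti : StrictAntiOn (fun r => r ^ (N - 1) * du r * v r - r ^ (N - 1) * dv r * u r)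
      (Icc 0 R) := by
    refine strictAntiOn_of_deriv_neg (convex_Icc 0 R) ?_ fun s hs => ?_
    · have hpow : ContinuousOn (fun r : ℝ => r ^ (N - 1)) (Ici 0) := by fun_prop
      exact (((hpow.mul h.dcont).mul hv.cont).sub ((hpow.mul hv.dcont).mul h.cont)).mono
        Icc_subset_Ici_self
    · rw [interior_Icc] at hs
      have h1 := (hasDerivAt_pow_mul (g := fun r => f (u r)) (by omega) hs.1
        (h.hasDerivAt' s hs.1)).mul (hv.hasDerivAt s hs.1)
      have h2 := (hasDerivAt_pow_mul (g := fun r => f (v r)) (by omega) hs.1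
        (hv.hasDerivAt' s hs.1)).mul (h.hasDerivAt s hs.1)
      have h3 := h1.sub h2
      have h4 := h3.deriv
      have h5 : f (v s) * u s < f (u s) * v s :=
        hf.mul_lt_mul (hpos s ⟨hs.1.le, hs.2⟩) (hlt s ⟨hs.1.le, hs.2⟩)
      have h6 := mul_lt_mul_of_pos_left h5 (pow_pos hs.1 (N - 1))
      refine lt_of_eq_of_lt h4 ?_
      linarith
  have h1 := hanti ⟨le_rfl, hR.le⟩ ⟨hR.le, le_rfl⟩ hR
  simp only [h.dinit, hv.dinit, hvR] at h1
  have h2 := hv.du_neg hN hf hR fun s hs => hpos s ⟨hs.1.le, hs.2⟩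
  have h3 := h.pos_of_isStable hN hf hα hst hR.le
  have h4 := mul_pos (mul_pos (pow_pos hR (N - 1)) (neg_pos.2 h2)) h3
  linarith

lemma lt_of_isStable (hN : 2 ≤ N) (hf : IsAdmissible f) (hα : 0 < α)
    (h : IsProfile N f α u du) (hst : IsStable f (radial N u)) {β : ℝ} {v dv : ℝ → ℝ}
    (hβ : 0 < β) (hβα : β < α) (hv : IsProfile N f β v dv) {r : ℝ} (hr : 0 ≤ r) : v r < u r :=
  h.lt_of_isStable_of_pos hN hf hst hβα hv hr fun _ hs =>
    h.pos_of_isStable_of_lt hN hf hα hst hβ hβα hv hs.1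

/-- By the ordering `0 < v < u`, the potential `f'(v)` lies below `f'(u)`. This is why the stable
initial values form an interval. -/
lemma isStable_of_lt (hN : 2 ≤ N) (hf : IsAdmissible f) (hα : 0 < α)
    (h : IsProfile N f α u du) (hst : IsStable f (radial N u)) {β : ℝ} {v dv : ℝ → ℝ}
    (hβ : 0 < β) (hβα : β < α) (hv : IsProfile N f β v dv) : IsStable f (radial N v) := by
  refine hst.mono hf.continuous_deriv h.cont hv.cont fun r hr => ?_
  have h1 := h.pos_of_isStable_of_lt hN hf hα hst hβ hβα hv hr
  have h2 := h.lt_of_isStable hN hf hα hst hβ hβα hv hr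
  exact hf.strictMonoOn_deriv.monotoneOn h1.le (h1.trans h2).le h2.le

end IsProfile

/-! ### Stability for small initial values -/

/-- Weighted arithmetic-geometric mean inequality for `1` and `t^(k+1)`, with weights `1/(k+1)` and
`k/(k+1)`. -/
lemma add_one_mul_rpow_le {k t : ℝ} (hk : 0 < k) (ht : 0 ≤ t) :
    (k + 1) * t ^ k ≤ 1 + k * (t ^ k * t) := by
  rcases ht.eq_or_lt with rfl | ht'
  · simp [Real.zero_rpow hk.ne']
  have h := Real.geom_mean_le_arith_mean2_weighted (w₁ := 1 / (k + 1)) (w₂ := k / (k + 1))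
    (p₁ := 1) (p₂ := t ^ (k + 1)) (by positivity) (by positivity) zero_le_one (by positivity)
    (by field_simp; ring)
  rw [Real.one_rpow, one_mul, ← Real.rpow_mul ht, mul_div_cancel₀ _ (by positivity),
    Real.rpow_add_one ht'.ne'] at h
  have h2 := mul_le_mul_of_nonneg_left h (by positivity : 0 ≤ k + 1)
  refine h2.trans_eq ?_
  field_simp

namespace IsProfile

variable {N : ℕ} {f : ℝ → ℝ} {α : ℝ} {u du : ℝ → ℝ}

lemma hasDerivAt_tail (hf : IsAdmissible f) (h : IsProfile N f α u du) {r : ℝ} (hr : 0 < r)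
    (hu : 0 < u r) : HasDerivAt (fun r => tailIntegral f (u r)) (-(du r / f (u r))) r := by
  refine ((hf.hasDerivAt_tailIntegral hu).comp r (h.hasDerivAt r hr)).congr_deriv ?_
  ring

/-- The equation for `V = F(u)`: `V'' + (N-1)V'/r = 1 + f'(u)V'²`. The nonlinearity enters only
through `f'(u) = (f'F)(u)/V`, whose numerator the hypotheses control. -/
lemma hasDerivAt_tail' (hf : IsAdmissible f) (h : IsProfile N f α u du) {r : ℝ} (hr : 0 < r)
    (hu : 0 < u r) : HasDerivAt (fun r => -(du r / f (u r)))
      (1 + deriv f (u r) * (-(du r / f (u r))) ^ 2 - ((N : ℝ) - 1) / r * -(du r / f (u r))) r := by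
  have hfu := (hf.pos _ hu).ne'
  refine (((h.hasDerivAt' r hr).div ((hf.hasDerivAt (u r)).comp r (h.hasDerivAt r hr))
    hfu).neg).congr_deriv ?_
  simp only [Function.comp]
  field_simp
  ring

lemma continuousOn_tail (hf : IsAdmissible f) (h : IsProfile N f α u du) {R : ℝ}
    (hpos : ∀ r ∈ Icc 0 R, 0 < u r) : ContinuousOn (fun r => tailIntegral f (u r)) (Icc 0 R) :=
  fun r hr => (hf.continuousAt_tailIntegral (hpos r hr)).comp_continuousWithinAt
    ((h.cont r hr.1).mono Icc_subset_Ici_self)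

lemma continuousOn_tail' (hf : IsAdmissible f) (h : IsProfile N f α u du) {R : ℝ}
    (hpos : ∀ r ∈ Icc 0 R, 0 < u r) : ContinuousOn (fun r => -(du r / f (u r))) (Icc 0 R) :=
  ((h.dcont.mono Icc_subset_Ici_self).div (hf.continuous.comp_continuousOn
    (h.cont.mono Icc_subset_Ici_self)) fun r hr => (hf.pos _ (hpos r hr)).ne').neg

/-- Comparison with the singular solution: if `f' F ≥ q` along a positive solution, then
`r² < (2N - 4q) F(u(r))`. -/
lemma sq_lt_mul_tail (hf : IsAdmissible f) (hα : 0 < α) (h : IsProfile N f α u du) {q : ℝ}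
    (hq1 : 1 < q) (hqN : 4 * q < N) (hq : q * (2 * N - 4 * q) < (((N : ℝ) - 2) / 2) ^ 2)
    {R : ℝ} (hpos : ∀ r ∈ Ico 0 R, 0 < u r)
    (hqu : ∀ r ∈ Ioo 0 R, q ≤ deriv f (u r) * tailIntegral f (u r)) {r : ℝ} (hr : r ∈ Ioo 0 R) :
    r ^ 2 < (2 * N - 4 * q) * tailIntegral f (u r) := by
  set V : ℝ → ℝ := fun r => tailIntegral f (u r) with hVdef
  set dv : ℝ → ℝ := fun r => -(du r / f (u r)) with hdvdef
  -- `r²/Y` is the explicit singular solution of `V'' + (N-1)V'/r = 1 + qV'²/V`.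
  set Y : ℝ := 2 * N - 4 * q with hY
  set k : ℝ := q - 1 with hk
  set b : ℝ := ((N : ℝ) - 2) / 2 with hb
  set m : ℝ := b - 2 * k with hm
  have hk0 : 0 < k := by linarith
  have hm0 : 0 < m := by linarith
  have hY0 : 0 < Y := by linarith
  have hposr : ∀ s ∈ Icc 0 r, 0 < u s := fun s hs => hpos s ⟨hs.1, hs.2.trans_lt hr.2⟩
  by_contra! hle
  obtain ⟨c, hc, hcr, hdc, hdpos⟩ := exists_first_zero (d := fun s => Y * V s - s ^ 2) hr.1.le
    ((continuousOn_const.mul (h.continuousOn_tail hf hposr)).sub (by fun_prop))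
    (by
      have := mul_pos hY0 (hf.tailIntegral_pos hα)
      simpa [hVdef, h.init] using this)
    (by linarith)
  have hposc : ∀ s ∈ Icc 0 c, 0 < u s := fun s hs => hposr s ⟨hs.1, hs.2.trans hcr⟩
  have hVpos : ∀ s ∈ Icc 0 c, 0 < V s := fun s hs => hf.tailIntegral_pos (hposc s hs)
  have hVc : ContinuousOn V (Icc 0 c) := h.continuousOn_tail hf hposc
  have hdvc : ContinuousOn dv (Icc 0 c) := h.continuousOn_tail' hf hposc
  have hVd : ∀ s ∈ Ioc 0 c, HasDerivAt V (dv s) s := fun s hs =>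
    h.hasDerivAt_tail hf hs.1 (hposc s ⟨hs.1.le, hs.2⟩)
  have hdvd : ∀ s ∈ Ioc 0 c, HasDerivAt dv
      (1 + deriv f (u s) * dv s ^ 2 - ((N : ℝ) - 1) / s * dv s) s := fun s hs =>
    h.hasDerivAt_tail' hf hs.1 (hposc s ⟨hs.1.le, hs.2⟩)
  set y : ℝ → ℝ := fun s => s ^ 2 / V s with hydef
  set X : ℝ → ℝ := fun s => s * dv s / V s with hXdef
  set E : ℝ → ℝ := fun s => y s ^ k with hEdef
  -- Since `s E' = k(2 - X)E`, this is `s (s^m (Y^k - E))'`. The power `k = q - 1` makes `V^(-k)`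
  -- proportional to `u` when `f` is a pure power with `f'F = q`. As long as `y < Y`, `W` increases
  -- from `0`; at a first contact `y = Y` it would have to be nonpositive.
  set W : ℝ → ℝ := fun s => s ^ m * (m * Y ^ k - (b - k * X s) * E s) with hWdef
  have hyc : ContinuousOn y (Icc 0 c) :=
    (by fun_prop : ContinuousOn (fun s : ℝ => s ^ 2) (Icc 0 c)).div hVc fun s hs => (hVpos s hs).ne'
  have hXc : ContinuousOn X (Icc 0 c) :=
    (continuousOn_id.mul hdvc).div hVc fun s hs => (hVpos s hs).ne'
  have hEc : ContinuousOn E (Icc 0 c) := hyc.rpow_const fun s hs => Or.inr hk0.le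
  have hWc : ContinuousOn W (Icc 0 c) :=
    (continuousOn_id.rpow_const fun s hs => Or.inr hm0.le).mul
      (continuousOn_const.sub ((continuousOn_const.sub (continuousOn_const.mul hXc)).mul hEc))
  have hWmono : StrictMonoOn W (Icc 0 c) := by
    refine strictMonoOn_of_deriv_pos (convex_Icc 0 c) hWc fun s hs => ?_
    rw [interior_Icc] at hs
    have hs' : s ∈ Ioc 0 c := ⟨hs.1, hs.2.le⟩
    have hs0 : s ≠ 0 := hs.1.ne'
    have hVs : 0 < V s := hVpos s ⟨hs.1.le, hs.2.le⟩
    have hy0 : 0 < y s := div_pos (pow_pos hs.1 2) hVs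
    have hyd : HasDerivAt y (y s * (2 - X s) / s) s := by
      refine ((hasDerivAt_pow 2 s).div (hVd s hs') hVs.ne').congr_deriv ?_
      simp only [hydef, hXdef]
      field_simp
      ring
    have hEd : HasDerivAt E (k * E s * (2 - X s) / s) s := by
      refine (hyd.rpow_const (p := k) (Or.inl hy0.ne')).congr_deriv ?_
      rw [Real.rpow_sub_one hy0.ne']
      simp only [hEdef]
      field_simp
    have hXd : HasDerivAt X ((y s + (deriv f (u s) * V s - 1) * X s ^ 2 - 2 * b * X s) / s) s := by
      refine (((hasDerivAt_id s).mul (hdvd s hs')).div (hVd s hs') hVs.ne').congr_deriv ?_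
      simp only [hydef, hXdef, hb, id, Pi.mul_apply]
      field_simp
      ring
    have hWd : HasDerivAt W (s ^ m / s * (m ^ 2 * Y ^ k - b ^ 2 * E s + k * y s * E s
        + k * (deriv f (u s) * V s - q) * X s ^ 2 * E s)) s := by
      refine (((hasDerivAt_id s).rpow_const (p := m) (Or.inl hs0)).mul
        (((((hXd.const_mul k).const_sub b)).mul hEd).const_sub (m * Y ^ k))).congr_deriv ?_
      simp only [id]
      rw [Real.rpow_sub_one hs0, hm]
      simp only [hk, Pi.mul_apply]
      field_simp
      ring
    rw [hWd.deriv]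
    refine mul_pos (div_pos (Real.rpow_pos_of_pos hs.1 _) hs.1) ?_
    have hE0 : 0 < E s := Real.rpow_pos_of_pos hy0 k
    have h1 : 0 ≤ k * (deriv f (u s) * V s - q) * X s ^ 2 * E s := by
      have := hqu s ⟨hs.1, hs.2.trans_le (hcr.trans hr.2.le)⟩
      have : 0 ≤ deriv f (u s) * V s - q := by linarith
      positivity
    set t : ℝ := y s / Y
    have ht0 : 0 < t := div_pos hy0 hY0
    have ht1 : t < 1 := by
      rw [div_lt_one hY0, hydef, div_lt_iff₀ hVs]
      linarith [hdpos s ⟨hs.1.le, hs.2⟩]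
    have hyt : y s = Y * t := by simp only [t]; field_simp
    have hEt : E s = Y ^ k * t ^ k := by
      simp only [hEdef, hyt]
      exact Real.mul_rpow hY0.le ht0.le
    have htk : t ^ k < 1 := Real.rpow_lt_one ht0.le ht1 hk0
    have h2 := add_one_mul_rpow_le hk0 ht0.le
    have hYk : 0 < Y ^ k := Real.rpow_pos_of_pos hY0 k
    -- The first summand is positive by the Hardy condition `qY < b²` and `t < 1`; the second is
    -- nonnegative by `add_one_mul_rpow_le`.
    have h3 : m ^ 2 * Y ^ k - b ^ 2 * E s + k * y s * E s
        = Y ^ k * ((b ^ 2 - q * Y) * (1 - t ^ k) + Y * (1 + k * (t ^ k * t) - (k + 1) * t ^ k)) := by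
      rw [hEt, hyt]
      have : m ^ 2 = b ^ 2 - k * Y := by
        simp only [hm, hY, hb, hk]; ring
      rw [this]
      simp only [hk]
      ring
    have h4 : 0 < (b ^ 2 - q * Y) * (1 - t ^ k) := mul_pos (by linarith) (by linarith)
    have h5 : 0 ≤ Y * (1 + k * (t ^ k * t) - (k + 1) * t ^ k) := mul_nonneg hY0.le (by linarith)
    rw [h3]
    have := mul_pos hYk (add_pos_of_pos_of_nonneg h4 h5)
    linarith
  have hW0 : W 0 = 0 := by simp [hWdef, Real.zero_rpow hm0.ne']
  have hW := hWmono ⟨le_rfl, hc.le⟩ ⟨hc.le, le_rfl⟩ hc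
  rw [hW0] at hW
  have hcc : c ∈ Ioc 0 c := ⟨hc, le_rfl⟩
  have hd' := deriv_nonpos_of_first_zero hc
    (((hVd c hcc).const_mul Y).sub (hasDerivAt_pow 2 c)) hdc
    fun s hs => hdpos s ⟨hs.1.le, hs.2⟩
  have hVcpos : 0 < V c := hVpos c ⟨hc.le, le_rfl⟩
  have hyY : y c = Y := by
    simp only [hydef]
    rw [div_eq_iff hVcpos.ne']
    linarith
  have hX2 : X c ≤ 2 := by
    simp only [hXdef]
    rw [div_le_iff₀ hVcpos]
    have h1 : Y * (c * dv c) ≤ Y * (2 * V c) := by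
      norm_num at hd'
      nlinarith
    exact le_of_mul_le_mul_left h1 hY0
  have hWc' : W c = c ^ m * (Y ^ k * (k * (X c - 2))) := by
    simp only [hWdef, hEdef, hyY, hm]
    ring
  have : W c ≤ 0 := by
    rw [hWc']
    refine mul_nonpos_of_nonneg_of_nonpos (by positivity) ?_
    refine mul_nonpos_of_nonneg_of_nonpos (by positivity) ?_
    exact mul_nonpos_of_nonneg_of_nonpos hk0.le (by linarith)
  linarith

end IsProfile

/-- Both claims come from `(N-2)²/4 - q(2N-4q) = (N/2-2q)² - (N-1)` and `N/2 - 2q > √(N-1)`. -/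
lemma mul_lt_of_lt_qJL {N : ℕ} (hN : 1 ≤ N) {q : ℝ} (hq : q < qJL N) :
    4 * q < N ∧ q * (2 * N - 4 * q) < (((N : ℝ) - 2) / 2) ^ 2 := by
  have hN' : (1 : ℝ) ≤ N := by exact_mod_cast hN
  have hs := Real.sq_sqrt (by linarith : (0 : ℝ) ≤ (N : ℝ) - 1)
  have hs0 := Real.sqrt_nonneg ((N : ℝ) - 1)
  unfold qJL at hq
  set s := √((N : ℝ) - 1)
  refine ⟨by linarith, ?_⟩
  have h1 : 0 < (N : ℝ) / 2 - 2 * q - s := by linarith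
  have h2 : 0 < (N : ℝ) / 2 - 2 * q + s := by linarith
  nlinarith [mul_pos h1 h2]

/-- Solutions with small initial value are stable. -/
lemma exists_forall_le_isStable {N : ℕ} (hN : 3 ≤ N) {f : ℝ → ℝ} (hf : IsAdmissible f) {q₀ : ℝ}
    (hq₀ : Tendsto (fun u => deriv f u * tailIntegral f u) (𝓝[>] 0) (𝓝 q₀))
    (h1 : 1 < q₀) (h2 : q₀ < qJL N) :
    ∃ α₀ > 0, ∀ α > 0, α ≤ α₀ → ∀ u du, IsProfile N f α u du → IsStable f (radial N u) := by
  obtain ⟨h3, h4⟩ := mul_lt_of_lt_qJL (by omega) h2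
  have hN0 : (3 : ℝ) ≤ N := by exact_mod_cast hN
  obtain ⟨ε, ⟨hε1, hε2⟩, hε⟩ : ∃ ε : ℝ, (1 < q₀ - ε ∧
      (q₀ + ε) * (2 * N - 4 * (q₀ - ε)) < (((N : ℝ) - 2) / 2) ^ 2) ∧ 0 < ε := by
    have e1 : ∀ᶠ ε in 𝓝 (0 : ℝ), 1 < q₀ - ε :=
      (Continuous.tendsto (f := fun ε : ℝ => q₀ - ε) (by fun_prop) 0).eventually
        (lt_mem_nhds (by simpa using h1))
    have e2 : ∀ᶠ ε in 𝓝 (0 : ℝ), (q₀ + ε) * (2 * N - 4 * (q₀ - ε)) < (((N : ℝ) - 2) / 2) ^ 2 :=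
      (Continuous.tendsto (f := fun ε : ℝ => (q₀ + ε) * (2 * N - 4 * (q₀ - ε)))
        (by fun_prop) 0).eventually (gt_mem_nhds (by simpa using h4))
    have e3 : ∀ᶠ ε in 𝓝[>] (0 : ℝ), 0 < ε := eventually_mem_nhdsWithin
    exact ((((e1.and e2).filter_mono nhdsWithin_le_nhds).and e3)).exists
  have hev : ∀ᶠ u in 𝓝[>] 0, deriv f u * tailIntegral f u ∈ Ioo (q₀ - ε) (q₀ + ε) :=
    hq₀.eventually (Ioo_mem_nhds (by linarith) (by linarith))
  obtain ⟨a, ha, hau⟩ := (mem_nhdsGT_iff_exists_Ioc_subset).1 hev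
  refine ⟨a, ha, fun α hα hαa u du h => ?_⟩
  have hqu : ∀ r ≥ 0, 0 < u r → deriv f (u r) * tailIntegral f (u r) ∈ Ioo (q₀ - ε) (q₀ + ε) := by
    intro r hr hur
    have := h.abs_le_init (by omega) hf.continuous hf.odd hf.pos hr
    rw [abs_of_pos hα] at this
    exact hau ⟨hur, (le_abs_self _).trans (this.trans hαa)⟩
  -- The lower bound `q₀ - ε` on `f'F` feeds the comparison `r² < (2N - 4(q₀ - ε))F(u)`; the upper
  -- bound `q₀ + ε` converts it into a bound on `r² f'(u)`. Only an interval of positivity is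
  -- assumed, because global positivity is deduced from this estimate.
  have hhardy : ∀ R, (∀ r ∈ Ico 0 R, 0 < u r) → ∀ r ∈ Ioo 0 R,
      r ^ 2 * deriv f (u r) ≤ (((N : ℝ) - 2) / 2) ^ 2 := by
    intro R hpos r hr
    have hY : 0 < 2 * (N : ℝ) - 4 * (q₀ - ε) := by linarith
    have h5 := h.sq_lt_mul_tail hf hα hε1 (by linarith) (by nlinarith) hpos
      (fun s hs => (hqu s hs.1.le (hpos s ⟨hs.1.le, hs.2⟩)).1.le) hr
    have hur := hpos r ⟨hr.1.le, hr.2⟩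
    have h6 := (hqu r hr.1.le hur).2
    have h7 := mul_lt_mul_of_pos_right h5 (hf.deriv_pos _ hur)
    have h8 := mul_lt_mul_of_pos_left h6 hY
    nlinarith
  have hpos : ∀ r ≥ 0, 0 < u r := by
    intro r hr
    refine h.pos_of_test (by omega) hf hα (fun R hR hpos huR => ?_) hr
    obtain ⟨n, rfl⟩ : ∃ n, N = n + 3 := ⟨N - 3, by omega⟩
    have hu : ContinuousOn u (Icc 0 R) := h.cont.mono Icc_subset_Ici_self
    refine le_trans ?_ (hardy_interval n hR.le hu (h.dcont.mono Icc_subset_Ici_self)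
      (fun r hr => h.hasDerivAt r hr.1) huR)
    have hV : ContinuousOn (fun r => deriv f (u r)) (Icc 0 R) :=
      hf.continuous_deriv.comp_continuousOn hu
    refine integral_le_integral_Icc hR.le
      ((by fun_prop : ContinuousOn (fun r : ℝ => r ^ (n + 3 - 1)) (Icc 0 R)).mul (hV.mul (hu.pow 2)))
      (continuousOn_const.mul
        ((by fun_prop : ContinuousOn (fun r : ℝ => r ^ n) (Icc 0 R)).mul (hu.pow 2)))
      fun r hr => ?_
    have h5 := hhardy R hpos r hr
    have h6 := mul_le_mul_of_nonneg_right h5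
      (mul_nonneg (pow_nonneg hr.1.le n) (sq_nonneg (u r)))
    push_cast at h6
    change r ^ (n + 2) * (deriv f (u r) * u r ^ 2) ≤ (((n : ℝ) + 1) / 2) ^ 2 * (r ^ n * u r ^ 2)
    have h7 : (n : ℝ) + 3 - 2 = n + 1 := by ring
    rw [h7] at h6
    refine le_trans (le_of_eq ?_) h6
    ring
  exact isStable_of_hardy hN hf.continuous_deriv h.cont fun r hr =>
    hhardy (r + 1) (fun s hs => hpos s hs.1) r ⟨hr, by linarith⟩

/-! ### Instability for large initial values -/

namespace IsProfile

variable {N : ℕ} {f : ℝ → ℝ} {α : ℝ} {u du : ℝ → ℝ}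

/-- Decay of the potential along stable solutions. -/
lemma sq_mul_deriv_le (hN : 2 ≤ N) (hf : IsAdmissible f) (hα : 0 < α) (h : IsProfile N f α u du)
    (hst : IsStable f (radial N u)) {R : ℝ} (hR : 0 < R) :
    R ^ 2 * deriv f (u R) ≤ N * (N + 4) / 2 := by
  obtain ⟨n, rfl⟩ : ∃ n, N = n + 1 := ⟨N - 1, by omega⟩
  have hpos : ∀ r ≥ 0, 0 < u r := fun r hr => h.pos_of_isStable hN hf hα hst hr
  have hV : ContinuousOn (fun r => deriv f (u r)) (Icc 0 R) :=
    hf.continuous_deriv.comp_continuousOn (h.cont.mono Icc_subset_Ici_self)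
  -- Test with `R² - s²`, and bound `f'(u(s))` below by `f'(u(R))` since `u` decreases. The
  -- integrals are `8Rⁿ⁺⁵/((n+1)(n+3)(n+5))` and `4Rⁿ⁺³/(n+3)`, whence the constant `(n+1)(n+5)/2 =
  -- N(N+4)/2`.
  have h1 := hst.radial_ineq (by omega) hf.continuous_deriv h.cont
    (η := fun s => R ^ 2 - s ^ 2) (dη := fun s => -(2 * s)) hR (by fun_prop) (by fun_prop)
    (fun s _ => by simpa using (hasDerivAt_pow 2 s).const_sub (R ^ 2)) (by simp)
    (fun s hs => by nlinarith [hs.1, hs.2]) (by simp)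
  have h2 : ∫ s in 0..R, deriv f (u R) * (R ^ 4 * s ^ n - 2 * R ^ 2 * s ^ (n + 2) + s ^ (n + 4)) ≤
      ∫ s in 0..R, s ^ (n + 1 - 1) * (deriv f (u s) * (R ^ 2 - s ^ 2) ^ 2) := by
    refine integral_le_integral_Icc hR.le (by fun_prop)
      ((by fun_prop : ContinuousOn (fun s : ℝ => s ^ (n + 1 - 1)) (Icc 0 R)).mul
        (hV.mul (by fun_prop))) fun s hs => ?_
    have hle : deriv f (u R) ≤ deriv f (u s) :=
      hf.strictMonoOn_deriv.monotoneOn (hpos R hR.le).le (hpos s hs.1.le).le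
        ((h.strictAntiOn hN hf (R := R) fun x hx => hpos x hx.1.le).antitoneOn
          ⟨hs.1.le, hs.2.le⟩ ⟨hR.le, le_rfl⟩ hs.2.le)
    have := mul_le_mul_of_nonneg_right hle
      (mul_nonneg (pow_nonneg hs.1.le n) (sq_nonneg (R ^ 2 - s ^ 2)))
    simp only [Nat.add_sub_cancel]
    refine le_trans (le_of_eq ?_) (this.trans (le_of_eq ?_)) <;> ring
  have h3 := h2.trans h1
  have h4 : ∀ s : ℝ, s ^ (n + 1 - 1) * (-(2 * s)) ^ 2 = 4 * s ^ (n + 2) := fun s => by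
    simp only [Nat.add_sub_cancel]; ring
  simp only [h4] at h3
  rw [intervalIntegral.integral_const_mul, intervalIntegral.integral_const_mul,
    intervalIntegral.integral_add (Continuous.intervalIntegrable (by fun_prop) _ _)
      (Continuous.intervalIntegrable (by fun_prop) _ _),
    intervalIntegral.integral_sub (Continuous.intervalIntegrable (by fun_prop) _ _)
      (Continuous.intervalIntegrable (by fun_prop) _ _),
    intervalIntegral.integral_const_mul, intervalIntegral.integral_const_mul,
    integral_pow, integral_pow, integral_pow] at h3
  have hn : (0 : ℝ) ≤ n := Nat.cast_nonneg n
  simp only [ne_eq, Nat.add_eq_zero_iff, OfNat.ofNat_ne_zero, one_ne_zero, and_false,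
    not_false_eq_true, zero_pow, sub_zero] at h3
  push_cast at h3 ⊢
  have h5 : deriv f (u R) * (R ^ 4 * (R ^ (n + 1) / ((n : ℝ) + 1)) -
      2 * R ^ 2 * (R ^ (n + 2 + 1) / ((n : ℝ) + 2 + 1)) + R ^ (n + 4 + 1) / ((n : ℝ) + 4 + 1)) =
      R ^ (n + 3) * (8 * (R ^ 2 * deriv f (u R)) / ((n + 1) * (n + 3) * (n + 5))) := by
    field_simp
    ring
  have h6 : 4 * (R ^ (n + 2 + 1) / ((n : ℝ) + 2 + 1)) = R ^ (n + 3) * (4 / (n + 3)) := by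
    field_simp
    ring
  rw [h5, h6] at h3
  have h7 := le_of_mul_le_mul_left h3 (pow_pos hR _)
  rw [div_le_div_iff₀ (by positivity) (by positivity)] at h7
  have h8 : (n + 3 : ℝ) * (8 * (R ^ 2 * deriv f (u R))) ≤ (n + 3 : ℝ) * (4 * ((n + 1) * (n + 5))) := by
    linarith
  have h9 := le_of_mul_le_mul_left h8 (by positivity)
  linarith

/-- Near the origin `F(u)` is controlled by its value at the origin. -/
lemma tail_le (hN : 2 ≤ N) (hf : IsAdmissible f) (hα : 0 < α) (h : IsProfile N f α u du)
    {R : ℝ} (hR : 0 ≤ R) (hpos : ∀ r ∈ Icc 0 R, 0 < u r) (hRα : R ^ 2 * deriv f α ≤ N) :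
    tailIntegral f (u R) ≤ tailIntegral f α + R ^ 2 / N := by
  have hN0 : (0 : ℝ) < N := by exact_mod_cast (by omega : 0 < N)
  have hle : ∀ r ≥ 0, u r ≤ α := fun r hr => by
    have := h.abs_le_init (by omega) hf.continuous hf.odd hf.pos hr
    rw [abs_of_pos hα] at this
    exact (le_abs_self _).trans this
  have hfα := hf.pos α hα
  have hdu : ∀ r ∈ Icc 0 R, -(r * f α / N) ≤ du r := by
    have hmono : MonotoneOn (fun r => r ^ (N - 1) * du r + f α / N * r ^ N) (Icc 0 R) := by
      have hd : ∀ s ∈ Ioo 0 R, HasDerivAt (fun r => r ^ (N - 1) * du r + f α / N * r ^ N)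
          (s ^ (N - 1) * (f α - f (u s))) s := fun s hs => by
        refine ((hasDerivAt_pow_mul (g := fun r => f (u r)) (by omega) hs.1
          (h.hasDerivAt' s hs.1)).add ((hasDerivAt_pow N s).const_mul (f α / N))).congr_deriv ?_
        field_simp
        ring
      refine monotoneOn_of_deriv_nonneg (convex_Icc 0 R)
        (((by fun_prop : ContinuousOn (fun r : ℝ => r ^ (N - 1)) (Icc 0 R)).mul
          (h.dcont.mono Icc_subset_Ici_self)).add (by fun_prop)) ?_ ?_
      · intro s hs
        rw [interior_Icc] at hs
        exact (hd s hs).differentiableAt.differentiableWithinAt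
      · intro s hs
        rw [interior_Icc] at hs
        rw [(hd s hs).deriv]
        have : f (u s) ≤ f α := hf.strictMonoOn.monotoneOn
          (hpos s (Ioo_subset_Icc_self hs)).le hα.le (hle s hs.1.le)
        exact mul_nonneg (pow_nonneg hs.1.le _) (by linarith)
    intro r hr
    rcases hr.1.eq_or_lt with rfl | hr0
    · simp [h.dinit]
    have h1 := hmono ⟨le_rfl, hR⟩ hr hr.1
    simp only [h.dinit, mul_zero, zero_pow (by omega : N ≠ 0), add_zero] at h1
    have h2 : r ^ (N - 1) * du r + f α / N * r ^ N = r ^ (N - 1) * (du r + r * f α / N) := by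
      obtain ⟨n, rfl⟩ : ∃ n, N = n + 1 := ⟨N - 1, by omega⟩
      simp only [Nat.add_sub_cancel]
      ring
    rw [h2] at h1
    have := nonneg_of_mul_nonneg_right h1 (pow_pos hr0 _)
    linarith
  have hu : ∀ r ∈ Icc 0 R, α - r ^ 2 * f α / (2 * N) ≤ u r := by
    have hmono : MonotoneOn (fun r => u r + f α / (2 * N) * r ^ 2) (Icc 0 R) := by
      have hd : ∀ s ∈ Ioo 0 R, HasDerivAt (fun r => u r + f α / (2 * N) * r ^ 2)
          (du s + s * f α / N) s := fun s hs => by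
        refine ((h.hasDerivAt s hs.1).add ((hasDerivAt_pow 2 s).const_mul _)).congr_deriv ?_
        field_simp
        simp
        ring
      refine monotoneOn_of_deriv_nonneg (convex_Icc 0 R)
        ((h.cont.mono Icc_subset_Ici_self).add (by fun_prop)) ?_ ?_
      · intro s hs
        rw [interior_Icc] at hs
        exact (hd s hs).differentiableAt.differentiableWithinAt
      · intro s hs
        rw [interior_Icc] at hs
        rw [(hd s hs).deriv]
        linarith [hdu s (Ioo_subset_Icc_self hs)]
    intro r hr
    have h1 := hmono ⟨le_rfl, hR⟩ hr hr.1
    simp only [h.init] at h1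
    have h2 : f α / (2 * N) * r ^ 2 = r ^ 2 * f α / (2 * N) := by ring
    linarith
  -- By convexity the loss `f(α) - f(u)` is at most `f'(α)(α - u) ≤ r² f'(α) f(α)/(2N)`, and `r²
  -- f'(α) ≤ N`.
  have hfu : ∀ r ∈ Icc 0 R, f α / 2 ≤ f (u r) := by
    intro r hr
    have hf' := hf.deriv_pos α hα
    have h1 : f α - f (u r) ≤ deriv f α * (α - u r) := by
      rcases (hle r hr.1).eq_or_lt with heq | hlt
      · simp [heq]
      · exact (hf.sub_bounds (hpos r hr).le hlt).2.le
    have h2 : deriv f α * (α - u r) ≤ deriv f α * (r ^ 2 * f α / (2 * N)) :=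
      mul_le_mul_of_nonneg_left (by linarith [hu r hr]) hf'.le
    have h3 : r ^ 2 * deriv f α ≤ N := by
      refine le_trans ?_ hRα
      have := hr.1
      have := hr.2
      gcongr
    have h4 : deriv f α * (r ^ 2 * f α / (2 * N)) = (r ^ 2 * deriv f α) / N * (f α / 2) := by
      field_simp
    have h5 : (r ^ 2 * deriv f α) / N ≤ 1 := (div_le_one hN0).2 h3
    have h6 := mul_le_mul_of_nonneg_right h5 (by linarith : 0 ≤ f α / 2)
    linarith
  have hanti : AntitoneOn (fun r => tailIntegral f (u r) - r ^ 2 / N) (Icc 0 R) := by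
    have hd : ∀ s ∈ Ioo 0 R, HasDerivAt (fun r => tailIntegral f (u r) - r ^ 2 / N)
        (-(du s / f (u s)) - 2 * s / N) s := fun s hs => by
      refine ((h.hasDerivAt_tail hf hs.1 (hpos s (Ioo_subset_Icc_self hs))).sub
        ((hasDerivAt_pow 2 s).div_const _)).congr_deriv ?_
      simp
    refine antitoneOn_of_deriv_nonpos (convex_Icc 0 R)
      ((h.continuousOn_tail hf hpos).sub (by fun_prop)) ?_ ?_
    · intro s hs
      rw [interior_Icc] at hs
      exact (hd s hs).differentiableAt.differentiableWithinAt
    · intro s hs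
      rw [interior_Icc] at hs
      rw [(hd s hs).deriv]
      have hs' := Ioo_subset_Icc_self hs
      have h1 : -du s ≤ 2 * s / N * f (u s) := by
        have h2 := hdu s hs'
        have h3 := mul_le_mul_of_nonneg_left (hfu s hs')
          (by have := hs.1; positivity : 0 ≤ 2 * s / N)
        have h4 : 2 * s / N * (f α / 2) = s * f α / N := by ring
        linarith
      have h5 : -du s / f (u s) ≤ 2 * s / N := by
        rwa [div_le_iff₀ (hf.pos _ (hpos s hs'))]
      rw [neg_div] at h5
      linarith
  have h1 := hanti ⟨le_rfl, hR⟩ ⟨hR, le_rfl⟩ hR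
  simp only [h.init] at h1
  norm_num at h1
  linarith

/-- A weighted integral estimate for stable solutions. -/
lemma weighted_estimate (hN : 2 ≤ N) (hf : IsAdmissible f) (h : IsProfile N f α u du)
    (hst : IsStable f (radial N u)) {R : ℝ} (hR : 0 < R) (hpos : ∀ r ∈ Icc 0 R, 0 < u r)
    {a l ε σ : ℝ} (hσ : 0 < σ)
    (hQ1 : ∀ r ∈ Icc 0 R, l + ε ≤ deriv f (u r) * tailIntegral f (u r))
    (hQ2 : ∀ r ∈ Icc 0 R, σ + a ^ 2 ≤ l * (2 * a + 1 - deriv f (u r) * tailIntegral f (u r)))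
    {η dη : ℝ → ℝ} (hη : ContinuousOn η (Icc 0 R)) (hdη : ContinuousOn dη (Icc 0 R))
    (hd : ∀ r ∈ Ioo 0 R, HasDerivAt η (dη r) r) (hd0 : dη 0 = 0)
    (hη0 : ∀ r ∈ Ico 0 R, 0 ≤ η r) (hηR : η R = 0) :
    ε * ∫ r in 0..R, r ^ (N - 1) *
        ((tailIntegral f (u r) ^ (-a)) ^ 2 / tailIntegral f (u r) * η r ^ 2) ≤
      (1 + (l - a) ^ 2 / σ) * ∫ r in 0..R, r ^ (N - 1) *
        ((tailIntegral f (u r) ^ (-a)) ^ 2 * dη r ^ 2) := by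
  set V : ℝ → ℝ := fun r => tailIntegral f (u r) with hVdef
  set dv : ℝ → ℝ := fun r => -(du r / f (u r)) with hdvdef
  set B : ℝ → ℝ := fun r => V r ^ (-a) with hBdef
  set x : ℝ → ℝ := fun r => dv r / V r with hxdef
  set D : ℝ → ℝ := fun r => deriv f (u r) with hDdef
  have hVpos : ∀ s ∈ Icc 0 R, 0 < V s := fun s hs => hf.tailIntegral_pos (hpos s hs)
  have hVc : ContinuousOn V (Icc 0 R) := h.continuousOn_tail hf hpos
  have hdvc : ContinuousOn dv (Icc 0 R) := h.continuousOn_tail' hf hpos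
  have hBc : ContinuousOn B (Icc 0 R) := hVc.rpow_const fun s hs => Or.inl (hVpos s hs).ne'
  have hxc : ContinuousOn x (Icc 0 R) := hdvc.div hVc fun s hs => (hVpos s hs).ne'
  have hDc : ContinuousOn D (Icc 0 R) :=
    hf.continuous_deriv.comp_continuousOn (h.cont.mono Icc_subset_Ici_self)
  have hpow : ContinuousOn (fun r : ℝ => r ^ (N - 1)) (Icc 0 R) := by fun_prop
  have hBd : ∀ r ∈ Ioo 0 R, HasDerivAt B (-(a * x r * B r)) r := fun r hr => by
    have hr' := Ioo_subset_Icc_self hr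
    refine ((h.hasDerivAt_tail hf hr.1 (hpos r hr')).rpow_const (p := -a)
      (Or.inl (hVpos r hr').ne')).congr_deriv ?_
    change dv r * -a * V r ^ (-a - 1) = _
    rw [Real.rpow_sub_one (hVpos r hr').ne']
    simp only [hxdef, hBdef]
    ring
  have hdv0 : dv 0 = 0 := by simp [hdvdef, h.dinit]
  have htest := hst.radial_ineq (by omega) hf.continuous_deriv h.cont
    (η := fun r => B r * η r) (dη := fun r => B r * (dη r - a * x r * η r)) hR (hBc.mul hη)
    (hBc.mul (hdη.sub ((continuousOn_const.mul hxc).mul hη)))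
    (fun r hr => by
      refine ((hBd r hr).mul (hd r hr)).congr_deriv ?_
      ring)
    (by simp [hd0, hxdef, hdv0])
    (fun r hr => mul_nonneg (Real.rpow_nonneg (hVpos r (Ico_subset_Icc_self hr)).le _) (hη0 r hr))
    (by simp [hηR])
  -- Derivative of `r^(N-1) V' V^(-2a-1) η²`, rewritten with the equation for `V`. Its integral
  -- vanishes, so any multiple can be added to the stability inequality; the multiple used is `-l`.
  set G' : ℝ → ℝ := fun r => r ^ (N - 1) * (B r ^ 2 * (η r ^ 2 / V r +
    (D r * V r - 2 * a - 1) * (x r ^ 2 * η r ^ 2) + 2 * (x r * (η r * dη r))))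
  have hG'c : ContinuousOn G' (Icc 0 R) :=
    hpow.mul ((hBc.pow 2).mul ((((hη.pow 2).div hVc fun s hs => (hVpos s hs).ne').add
      ((((hDc.mul hVc).sub continuousOn_const).sub continuousOn_const).mul
        ((hxc.pow 2).mul (hη.pow 2)))).add (continuousOn_const.mul (hxc.mul (hη.mul hdη)))))
  have hnull : ∫ r in 0..R, G' r = 0 := by
    rw [integral_eq_sub_of_hasDerivAt_Ioo
      (g := fun r => r ^ (N - 1) * dv r * (B r ^ 2 / V r * η r ^ 2)) hR.le
      ((hpow.mul hdvc).mul (((hBc.pow 2).div hVc fun s hs => (hVpos s hs).ne').mul (hη.pow 2)))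
      ?_ hG'c]
    · simp [hηR, hdv0]
    · intro r hr
      have hr' := Ioo_subset_Icc_self hr
      have hV0 := (hVpos r hr').ne'
      have h1 := h.hasDerivAt_tail' hf hr.1 (hpos r hr')
      have h2 : HasDerivAt (fun r => r ^ (N - 1) * dv r)
          (-(r ^ (N - 1) * (-(1 + D r * dv r ^ 2)))) r :=
        hasDerivAt_pow_mul (g := fun r => -(1 + D r * dv r ^ 2)) (by omega) hr.1
          (h1.congr_deriv (by simp only [hDdef, hdvdef]; ring))
      have h3 := h2.mul ((((hBd r hr).pow 2).div
        (h.hasDerivAt_tail hf hr.1 (hpos r hr')) hV0).mul ((hd r hr).pow 2))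
      refine h3.congr_deriv ?_
      have h4 : dv r = x r * V r := by simp only [hxdef]; field_simp
      simp only [G', Pi.pow_apply, Pi.mul_apply, Pi.div_apply]
      change -(r ^ (N - 1) * (-(1 + D r * dv r ^ 2))) * (B r ^ 2 / V r * η r ^ 2) +
        r ^ (N - 1) * dv r * (((2 : ℕ) * B r ^ (2 - 1) * -(a * x r * B r) * V r - B r ^ 2 * dv r)
          / V r ^ 2 * η r ^ 2 + B r ^ 2 / V r * ((2 : ℕ) * η r ^ (2 - 1) * dη r)) = _
      rw [h4]
      push_cast
      field_simp
      ring
  have hI1 : ContinuousOn (fun r => r ^ (N - 1) * (D r * (B r * η r) ^ 2)) (Icc 0 R) :=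
    hpow.mul (hDc.mul ((hBc.mul hη).pow 2))
  have hI2 : ContinuousOn (fun r => r ^ (N - 1) * (B r * (dη r - a * x r * η r)) ^ 2) (Icc 0 R) :=
    hpow.mul ((hBc.mul (hdη.sub ((continuousOn_const.mul hxc).mul hη))).pow 2)
  have hI3 : ContinuousOn (fun r => r ^ (N - 1) * (B r ^ 2 / V r * η r ^ 2)) (Icc 0 R) :=
    hpow.mul (((hBc.pow 2).div hVc fun s hs => (hVpos s hs).ne').mul (hη.pow 2))
  have hI4 : ContinuousOn (fun r => r ^ (N - 1) * (B r ^ 2 * dη r ^ 2)) (Icc 0 R) :=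
    hpow.mul ((hBc.pow 2).mul (hdη.pow 2))
  have hii : ∀ {g : ℝ → ℝ}, ContinuousOn g (Icc 0 R) → IntervalIntegrable g volume 0 R :=
    fun hg => hg.intervalIntegrable_of_Icc hR.le
  have hmain := integral_le_integral_Icc (g := fun r =>
      ε * (r ^ (N - 1) * (B r ^ 2 / V r * η r ^ 2)) + r ^ (N - 1) * (B r * (dη r - a * x r * η r)) ^ 2)
    (h := fun r => (1 + (l - a) ^ 2 / σ) * (r ^ (N - 1) * (B r ^ 2 * dη r ^ 2)) +
      r ^ (N - 1) * (D r * (B r * η r) ^ 2) - l * G' r) hR.le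
    ((continuousOn_const.mul hI3).add hI2)
    (((continuousOn_const.mul hI4).add hI1).sub (continuousOn_const.mul hG'c)) (fun r hr => by
    have hr' := Ioo_subset_Icc_self hr
    have hV0 := hVpos r hr'
    have hq1 : l + ε ≤ D r * V r := hQ1 r hr'
    have hq2 : σ + a ^ 2 ≤ l * (2 * a + 1 - D r * V r) := hQ2 r hr'
    have h1 : ε * (η r ^ 2 / V r) ≤ (D r * V r - l) * (η r ^ 2 / V r) :=
      mul_le_mul_of_nonneg_right (by linarith) (by positivity)
    have h2 : 0 ≤ (l * (2 * a + 1 - D r * V r) - a ^ 2 - σ) * (x r * η r) ^ 2 :=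
      mul_nonneg (by linarith) (sq_nonneg _)
    -- Once `hQ2` makes the coefficient of `(xη)²` at least `σ`, this square absorbs the cross term
    -- in `xηη'`, at the cost `(l-a)²/σ` in front of `η'²`.
    have h3 : 0 ≤ σ * (x r * η r + (a - l) / σ * dη r) ^ 2 := mul_nonneg hσ.le (sq_nonneg _)
    have h4 : σ * (x r * η r + (a - l) / σ * dη r) ^ 2 = σ * (x r * η r) ^ 2 +
        2 * (a - l) * (x r * (η r * dη r)) + (l - a) ^ 2 / σ * dη r ^ 2 := by
      field_simp
      ring
    have h5 : (D r * V r - l) * (η r ^ 2 / V r) = D r * η r ^ 2 - l * (η r ^ 2 / V r) := by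
      field_simp
    have h6 : ε * (η r ^ 2 / V r) + (dη r - a * x r * η r) ^ 2 ≤
        (1 + (l - a) ^ 2 / σ) * dη r ^ 2 + D r * η r ^ 2 - l * (η r ^ 2 / V r +
        (D r * V r - 2 * a - 1) * (x r ^ 2 * η r ^ 2) + 2 * (x r * (η r * dη r))) := by
      nlinarith
    have h7 := mul_le_mul_of_nonneg_left h6
      (mul_nonneg (pow_nonneg hr.1.le (N - 1)) (sq_nonneg (B r)))
    simp only [G']
    refine le_trans (le_of_eq ?_) (h7.trans (le_of_eq ?_)) <;> ring)
  rw [intervalIntegral.integral_add ((hii hI3).const_mul ε) (hii hI2),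
    intervalIntegral.integral_sub (((hii hI4).const_mul _).add (hii hI1)) ((hii hG'c).const_mul l),
    intervalIntegral.integral_add ((hii hI4).const_mul _) (hii hI1),
    intervalIntegral.integral_const_mul, intervalIntegral.integral_const_mul,
    intervalIntegral.integral_const_mul, hnull] at hmain
  linarith

end IsProfile

/-- With `s = √(N-1)`, `qJL N = ((s-1)/2)²`, and `((s-1)/2)² + (s-1)/2 = (s²-1)/4 = (N-2)/4`. -/
lemma lt_add_sqrt_of_qJL_lt {N : ℕ} (hN : 2 ≤ N) {q : ℝ} (hq : qJL N < q) :
    ((N : ℝ) - 2) / 4 < q + √q := by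
  have hN' : (2 : ℝ) ≤ N := by exact_mod_cast hN
  have hs := Real.sq_sqrt (by linarith : (0 : ℝ) ≤ (N : ℝ) - 1)
  have hs1 : 1 ≤ √((N : ℝ) - 1) := Real.one_le_sqrt.2 (by linarith)
  unfold qJL at hq
  set s := √((N : ℝ) - 1)
  have h1 : ((s - 1) / 2) ^ 2 < q := by nlinarith
  have h2 : (s - 1) / 2 < √q := Real.lt_sqrt_of_sq_lt h1
  nlinarith

/-- Not every solution is stable. -/
lemma exists_not_isStable {N : ℕ} (hN : 2 ≤ N) {f : ℝ → ℝ} (hf : IsAdmissible f) {q : ℝ}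
    (hq : Tendsto (fun u => deriv f u * tailIntegral f u) atTop (𝓝 q))
    (h1 : 1 < q) (h2 : qJL N < q) {u du : ℝ → ℝ → ℝ}
    (hu : ∀ α > 0, IsProfile N f α (u α) (du α)) :
    ∃ α > 0, ¬ IsStable f (radial N (u α)) := by
  by_contra! hst
  have hN0 : (2 : ℝ) ≤ N := by exact_mod_cast hN
  -- the exponents
  obtain ⟨a, hamax, haq⟩ := exists_between
    (max_lt (lt_add_sqrt_of_qJL_lt hN h2) (by linarith [Real.sqrt_pos.2 (by linarith : 0 < q)] :
      q < q + √q))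
  obtain ⟨haN, haq'⟩ := max_lt_iff.1 hamax
  -- This is equivalent to `(a-q)² < q`, which is where `a < q + √q` enters.
  have ha2 : a ^ 2 < q * (2 * a + 1 - q) := by
    have h3 : (a - q) ^ 2 < √q ^ 2 := by
      gcongr
      all_goals linarith
    rw [Real.sq_sqrt (by linarith)] at h3
    nlinarith
  obtain ⟨ε, ⟨hε1, hε2⟩, hε⟩ : ∃ ε : ℝ, (1 < q - 2 * ε ∧
      a ^ 2 < (q - 2 * ε) * (2 * a + 1 - (q + ε))) ∧ 0 < ε := by
    have e1 : ∀ᶠ ε in 𝓝 (0 : ℝ), 1 < q - 2 * ε :=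
      (Continuous.tendsto (f := fun ε : ℝ => q - 2 * ε) (by fun_prop) 0).eventually
        (lt_mem_nhds (by simpa using h1))
    have e2 : ∀ᶠ ε in 𝓝 (0 : ℝ), a ^ 2 < (q - 2 * ε) * (2 * a + 1 - (q + ε)) :=
      (Continuous.tendsto (f := fun ε : ℝ => (q - 2 * ε) * (2 * a + 1 - (q + ε)))
        (by fun_prop) 0).eventually (lt_mem_nhds (by simpa using ha2))
    have e3 : ∀ᶠ ε in 𝓝[>] (0 : ℝ), 0 < ε := eventually_mem_nhdsWithin
    exact ((((e1.and e2).filter_mono nhdsWithin_le_nhds).and e3)).exists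
  -- The gap between `l` and the lower bound `q - ε` of `f'F` supplies the factor `ε` on the left of
  -- `weighted_estimate`.
  set l := q - 2 * ε with hl
  set σ := l * (2 * a + 1 - (q + ε)) - a ^ 2 with hσdef
  have hσ : 0 < σ := by linarith
  obtain ⟨M, hM⟩ : ∃ M, ∀ s ≥ M, deriv f s * tailIntegral f s ∈ Ioo (q - ε) (q + ε) :=
    eventually_atTop.1 (hq.eventually (Ioo_mem_nhds (by linarith) (by linarith)))
  -- a ball on which all large solutions are large
  set α₁ := max M 0 + 1 with hα₁
  have hα₁0 : 0 < α₁ := by positivity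
  obtain ⟨R, hR0, hR1, hRM⟩ : ∃ R : ℝ, 0 < R ∧ R ≤ 1 ∧ ∀ r ∈ Icc 0 R, max M 0 < u α₁ r := by
    have h3 : ∀ᶠ r in 𝓝[Ici 0] 0, max M 0 < u α₁ r :=
      ((hu α₁ hα₁0).cont 0 self_mem_Ici).eventually
        (lt_mem_nhds (by rw [(hu α₁ hα₁0).init]; linarith))
    obtain ⟨ρ, hρ, hρM⟩ := mem_nhdsGE_iff_exists_Icc_subset.1 h3
    exact ⟨min ρ 1, lt_min hρ one_pos, min_le_right _ _, fun r hr =>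
      hρM ⟨hr.1, hr.2.trans (min_le_left _ _)⟩⟩
  -- Under the assumption that all solutions are stable they are ordered by `α`, so one radius `R`
  -- serves every `α > α₁`.
  have hlarge : ∀ α > α₁, ∀ r ∈ Icc 0 R, max M 0 < u α r := fun α hα r hr =>
    (hRM r hr).trans ((hu α (hα₁0.trans hα)).lt_of_isStable hN hf (hα₁0.trans hα)
      (hst α (hα₁0.trans hα)) hα₁0 hα (hu α₁ hα₁0) hr.1)
  have hupos : ∀ α > α₁, ∀ r ∈ Icc 0 R, 0 < u α r := fun α hα r hr =>
    (le_max_right _ _).trans_lt (hlarge α hα r hr)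
  have hQ : ∀ α > α₁, ∀ r ∈ Icc 0 R,
      deriv f (u α r) * tailIntegral f (u α r) ∈ Ioo (q - ε) (q + ε) := fun α hα r hr =>
    hM _ ((le_max_left _ _).trans (hlarge α hα r hr).le)
  -- With `η = R^(K+1) - r^(K+1)`, the factor `r^(2K)` in `η'²` compensates `V^(-2a)`, because `r²/V
  -- ≤ C` and `r ≤ 1`.
  obtain ⟨K, hK⟩ := exists_nat_gt (2 * a)
  have ha0 : 0 < a := by linarith
  have hK0 : K ≠ 0 := by
    rintro rfl
    norm_num at hK
    linarith
  set C : ℝ := N * (N + 4) / 2 with hC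
  have hC0 : 0 ≤ C := by positivity
  set S : ℝ := 1 + (l - a) ^ 2 / σ with hS
  have hS0 : 0 ≤ S := by positivity
  -- uniform bound of the weighted integrals
  have hupper : ∀ α > α₁, ε * ∫ r in 0..R, r ^ (N - 1) *
      ((tailIntegral f (u α r) ^ (-a)) ^ 2 / tailIntegral f (u α r) *
        (R ^ (K + 1) - r ^ (K + 1)) ^ 2) ≤ S * ((K + 1) ^ 2 * C ^ (2 * a)) := by
    intro α hα
    have hα0 := hα₁0.trans hα
    have h := hu α hα0
    have hVc := h.continuousOn_tail hf (hupos α hα)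
    have hVpos : ∀ s ∈ Icc 0 R, 0 < tailIntegral f (u α s) := fun s hs =>
      hf.tailIntegral_pos (hupos α hα s hs)
    have hest := h.weighted_estimate hN hf (hst α hα0) hR0 (hupos α hα) (a := a) (l := l) (ε := ε)
      hσ (fun r hr => by linarith [(hQ α hα r hr).1])
      (fun r hr => by
        have := (hQ α hα r hr).2
        have h3 : l * (2 * a + 1 - (q + ε)) ≤
            l * (2 * a + 1 - deriv f (u α r) * tailIntegral f (u α r)) :=
          mul_le_mul_of_nonneg_left (by linarith) (by linarith)
        linarith)
      (η := fun r => R ^ (K + 1) - r ^ (K + 1)) (dη := fun r => -((K + 1) * r ^ K))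
      (by fun_prop) (by fun_prop)
      (fun r _ => by simpa using (hasDerivAt_pow (K + 1) r).const_sub (R ^ (K + 1)))
      (by simp [hK0])
      (fun r hr => sub_nonneg.2 (pow_le_pow_left₀ hr.1 hr.2.le _)) (by simp)
    refine hest.trans (mul_le_mul_of_nonneg_left ?_ hS0)
    have hle : ∫ r in 0..R, r ^ (N - 1) *
        ((tailIntegral f (u α r) ^ (-a)) ^ 2 * (-((K + 1 : ℝ) * r ^ K)) ^ 2) ≤
        ∫ r in 0..R, (K + 1 : ℝ) ^ 2 * C ^ (2 * a) := by
      refine integral_le_integral_Icc hR0.le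
        ((by fun_prop : ContinuousOn (fun r : ℝ => r ^ (N - 1)) (Icc 0 R)).mul
          (((hVc.rpow_const fun s hs => Or.inl (hVpos s hs).ne').pow 2).mul (by fun_prop)))
        continuousOn_const fun r hr => ?_
      have hr' := Ioo_subset_Icc_self hr
      set V := tailIntegral f (u α r) with hV
      have hV0 : 0 < V := hVpos r hr'
      have hr1 : r ≤ 1 := hr.2.le.trans hR1
      have h3 : r ^ 2 / V ≤ C := by
        have h4 := h.sq_mul_deriv_le hN hf hα0 (hst α hα0) hr.1
        have h5 := (hQ α hα r hr').1
        rw [div_le_iff₀ hV0]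
        have h6 : r ^ 2 * 1 ≤ r ^ 2 * (deriv f (u α r) * V) :=
          mul_le_mul_of_nonneg_left (by linarith) (sq_nonneg r)
        have h7 := mul_le_mul_of_nonneg_right h4 hV0.le
        rw [hC]
        linarith
      have h4 : (V ^ (-a)) ^ 2 = (V ^ (2 * a))⁻¹ := by
        rw [← Real.rpow_natCast, ← Real.rpow_mul hV0.le, ← Real.rpow_neg hV0.le]
        congr 1
        push_cast
        ring
      have h5 : (r ^ K) ^ 2 ≤ (r ^ 2) ^ (2 * a) := by
        rw [← pow_mul, mul_comm, pow_mul, ← Real.rpow_natCast (r ^ 2) K]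
        exact Real.rpow_le_rpow_of_exponent_ge (pow_pos hr.1 2) (pow_le_one₀ hr.1.le hr1) hK.le
      have h6 : (V ^ (-a)) ^ 2 * (r ^ K) ^ 2 ≤ C ^ (2 * a) := by
        rw [h4]
        calc (V ^ (2 * a))⁻¹ * (r ^ K) ^ 2 ≤ (V ^ (2 * a))⁻¹ * (r ^ 2) ^ (2 * a) := by gcongr
          _ = (r ^ 2 / V) ^ (2 * a) := by
              rw [Real.div_rpow (sq_nonneg r) hV0.le]
              ring
          _ ≤ C ^ (2 * a) := by
              have := hr.1
              gcongr
      have h7 : r ^ (N - 1) ≤ 1 := pow_le_one₀ hr.1.le hr1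
      have h8 : (V ^ (-a)) ^ 2 * (-((K + 1 : ℝ) * r ^ K)) ^ 2 ≤ (K + 1 : ℝ) ^ 2 * C ^ (2 * a) := by
        have := mul_le_mul_of_nonneg_left h6 (sq_nonneg (K + 1 : ℝ))
        linarith
      calc _ ≤ 1 * ((V ^ (-a)) ^ 2 * (-((K + 1 : ℝ) * r ^ K)) ^ 2) := by gcongr
        _ ≤ _ := by linarith
    refine hle.trans ?_
    rw [intervalIntegral.integral_const, sub_zero, smul_eq_mul]
    exact mul_le_of_le_one_left (by positivity) hR1
  -- lower bound near the origin
  set c₀ : ℝ := 1 / (q + ε) with hc₀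
  have hc₀0 : 0 < c₀ := one_div_pos.2 (by linarith)
  have hc₀1 : c₀ ≤ 1 := by rw [hc₀, div_le_one (by linarith)]; linarith
  have hlower : ∀ α > α₁, √(c₀ * tailIntegral f α) ≤ R / 2 →
      (2 * tailIntegral f α) ^ (-(2 * a + 1)) * (R ^ (K + 1) / 2) ^ 2 *
        (√(c₀ * tailIntegral f α) ^ N / N) ≤
      ∫ r in 0..R, r ^ (N - 1) *
        ((tailIntegral f (u α r) ^ (-a)) ^ 2 / tailIntegral f (u α r) *
          (R ^ (K + 1) - r ^ (K + 1)) ^ 2) := by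
    intro α hα hρR
    have hα0 := hα₁0.trans hα
    have h := hu α hα0
    have hFα := hf.tailIntegral_pos hα0
    set ρ := √(c₀ * tailIntegral f α) with hρ
    have hρ0 : 0 ≤ ρ := Real.sqrt_nonneg _
    have hρsq : ρ ^ 2 = c₀ * tailIntegral f α := Real.sq_sqrt (by positivity)
    have hVc := h.continuousOn_tail hf (hupos α hα)
    have hVpos : ∀ s ∈ Icc 0 R, 0 < tailIntegral f (u α s) := fun s hs =>
      hf.tailIntegral_pos (hupos α hα s hs)
    set g : ℝ → ℝ := fun r => r ^ (N - 1) *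
        ((tailIntegral f (u α r) ^ (-a)) ^ 2 / tailIntegral f (u α r) *
          (R ^ (K + 1) - r ^ (K + 1)) ^ 2) with hg
    have hgc : ContinuousOn g (Icc 0 R) :=
      (by fun_prop : ContinuousOn (fun r : ℝ => r ^ (N - 1)) (Icc 0 R)).mul
        ((((hVc.rpow_const fun s hs => Or.inl (hVpos s hs).ne').pow 2).div hVc
          fun s hs => (hVpos s hs).ne').mul (by fun_prop))
    have hρR' : ρ ≤ R := by linarith
    have hg0 : ∀ r ∈ Icc 0 R, 0 ≤ g r := fun r hr => by
      have := hVpos r hr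
      have := hr.1
      simp only [hg]
      positivity
    have hgρ : ∫ r in 0..ρ, g r ≤ ∫ r in 0..R, g r := by
      refine intervalIntegral.integral_mono_interval le_rfl hρ0 hρR' ?_
        (hgc.intervalIntegrable_of_Icc hR0.le)
      exact (ae_restrict_mem measurableSet_Ioc).mono fun r hr => hg0 r (Ioc_subset_Icc_self hr)
    refine le_trans ?_ hgρ
    set A : ℝ := (2 * tailIntegral f α) ^ (-(2 * a + 1)) * (R ^ (K + 1) / 2) ^ 2 with hA
    have hint : ∫ r in 0..ρ, A * r ^ (N - 1) = A * (ρ ^ N / N) := by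
      obtain ⟨n, rfl⟩ : ∃ n, N = n + 1 := ⟨N - 1, by omega⟩
      rw [intervalIntegral.integral_const_mul, integral_pow]
      simp
    rw [← hint]
    refine integral_le_integral_Icc hρ0 (by fun_prop) (hgc.mono (Icc_subset_Icc_right hρR'))
      fun r hr => ?_
    have hrR : r ∈ Icc 0 R := ⟨hr.1.le, hr.2.le.trans hρR'⟩
    have hr2 : r ^ 2 ≤ c₀ * tailIntegral f α := by
      rw [← hρsq]
      have := hr.1
      have := hr.2
      gcongr
    have hQα : deriv f α * tailIntegral f α < q + ε := by
      have := (hQ α hα 0 ⟨le_rfl, hR0.le⟩).2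
      rwa [h.init] at this
    have hfα := hf.deriv_pos α hα0
    -- `c₀` is the reciprocal of the upper bound for `f'F`, chosen so that `r² f'(α) ≤ 1 ≤ N` and
    -- `tail_le` applies.
    have h3 : r ^ 2 * deriv f α ≤ 1 := by
      calc r ^ 2 * deriv f α ≤ c₀ * tailIntegral f α * deriv f α := by gcongr
        _ = c₀ * (deriv f α * tailIntegral f α) := by ring
        _ ≤ c₀ * (q + ε) := by gcongr
        _ = 1 := one_div_mul_cancel (by linarith)
    have hV2 : tailIntegral f (u α r) ≤ 2 * tailIntegral f α := by
      have h4 := h.tail_le hN hf hα0 hr.1.le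
        (fun s hs => hupos α hα s ⟨hs.1, hs.2.trans hrR.2⟩) (by linarith)
      have h5 : r ^ 2 / N ≤ tailIntegral f α := by
        rw [div_le_iff₀ (by linarith)]
        nlinarith
      linarith
    have hV0 := hVpos r hrR
    set V := tailIntegral f (u α r)
    have h4 : (V ^ (-a)) ^ 2 / V = V ^ (-(2 * a + 1)) := by
      rw [← Real.rpow_natCast, ← Real.rpow_mul hV0.le, ← Real.rpow_sub_one hV0.ne']
      congr 1
      push_cast
      ring
    have h5 : (2 * tailIntegral f α) ^ (-(2 * a + 1)) ≤ V ^ (-(2 * a + 1)) :=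
      Real.rpow_le_rpow_of_nonpos hV0 hV2 (by linarith)
    have h6 : R ^ (K + 1) / 2 ≤ R ^ (K + 1) - r ^ (K + 1) := by
      have h7 : r ^ (K + 1) ≤ (R / 2) ^ (K + 1) :=
        pow_le_pow_left₀ hr.1.le (hr.2.le.trans hρR) _
      have h8 : (R / 2) ^ (K + 1) ≤ R ^ (K + 1) / 2 := by
        rw [div_pow]
        gcongr
        exact le_self_pow₀ one_le_two (by omega)
      linarith
    simp only [hg, hA]
    rw [h4, mul_comm]
    have := hr.1
    gcongr
  -- divergence
  have hF := hf.tendsto_tailIntegral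
  have hev1 : ∀ᶠ α in atTop, √(c₀ * tailIntegral f α) ≤ R / 2 := by
    have h3 : Tendsto (fun s => √(c₀ * s)) (𝓝[>] 0) (𝓝 0) := by
      have : Tendsto (fun s => √(c₀ * s)) (𝓝 0) (𝓝 √(c₀ * 0)) :=
        Continuous.tendsto (by fun_prop) 0
      simpa using this.mono_left nhdsWithin_le_nhds
    exact ((h3.comp hF).eventually (gt_mem_nhds (by positivity : 0 < R / 2))).mono
      fun α hα => le_of_lt hα
  set A : ℝ := ε * (2 ^ (-(2 * a + 1)) * (R ^ (K + 1) / 2) ^ 2 * (√c₀ ^ N / N)) with hA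
  have hA0 : 0 < A := by
    have : 0 < √c₀ := Real.sqrt_pos.2 hc₀0
    positivity
  -- The condition `a > (N-2)/4` is used here: the power of `F(α) → 0` is negative.
  have hexp : (N : ℝ) / 2 - (2 * a + 1) < 0 := by linarith
  have hev2 : ∀ᶠ α in atTop, S * ((K + 1) ^ 2 * C ^ (2 * a)) <
      A * tailIntegral f α ^ ((N : ℝ) / 2 - (2 * a + 1)) :=
    (((tendsto_rpow_neg_nhdsGT_zero hexp).comp hF).const_mul_atTop hA0).eventually_gt_atTop _
  obtain ⟨α, ⟨hα1, hα2⟩, hα⟩ := ((hev1.and hev2).and (eventually_gt_atTop α₁)).exists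
  have hα0 := hα₁0.trans hα
  have hFα := hf.tailIntegral_pos hα0
  have h3 := mul_le_mul_of_nonneg_left (hlower α hα hα1) hε.le
  have h4 := h3.trans (hupper α hα)
  have h5 : ε * ((2 * tailIntegral f α) ^ (-(2 * a + 1)) * (R ^ (K + 1) / 2) ^ 2 *
      (√(c₀ * tailIntegral f α) ^ N / N)) =
      A * tailIntegral f α ^ ((N : ℝ) / 2 - (2 * a + 1)) := by
    rw [Real.mul_rpow zero_le_two hFα.le, Real.sqrt_mul hc₀0.le, mul_pow, sub_eq_add_neg,
      Real.rpow_add hFα]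
    have h6 : √(tailIntegral f α) ^ N = tailIntegral f α ^ ((N : ℝ) / 2) := by
      rw [Real.sqrt_eq_rpow, ← Real.rpow_natCast, ← Real.rpow_mul hFα.le]
      congr 1
      ring
    rw [h6, hA]
    ring
  rw [h5] at h4
  linarith

/-! ### The structure theorem -/

/-- The set of initial values of stable solutions is closed from the left. -/
lemma isStable_of_forall_lt {N : ℕ} (hN : 2 ≤ N) {f : ℝ → ℝ} (hf : IsAdmissible f)
    {u du : ℝ → ℝ → ℝ} (hu : ∀ α > 0, IsProfile N f α (u α) (du α)) {β : ℝ} (hβ : 0 < β)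
    (hst : ∀ α ∈ Ioo 0 β, IsStable f (radial N (u α))) : IsStable f (radial N (u β)) := by
  intro φ hφ hs
  obtain ⟨L, hL, hlip⟩ := hf.exists_lipschitz β
  obtain ⟨C, hC⟩ := isCompact_Icc.exists_bound_of_continuousOn (s := Icc (-β) β)
    hf.continuous_deriv.continuousOn
  have hb : ∀ α ∈ Ioc 0 β, ∀ r ≥ 0, u α r ∈ Icc (-β) β := fun α hα r hr => by
    have := (hu α hα.1).abs_le_init (by omega) hf.continuous hf.odd hf.pos hr
    rw [abs_of_pos hα.1] at this
    exact abs_le.1 (this.trans hα.2)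
  have hptw : ∀ r ≥ 0, Tendsto (fun α => u α r) (𝓝[<] β) (𝓝 (u β r)) := by
    intro r hr
    rw [tendsto_iff_norm_sub_tendsto_zero]
    have h1 : Tendsto (fun α : ℝ => √(Real.exp ((L + 1) * r) * (α - β) ^ 2)) (𝓝[<] β) (𝓝 0) := by
      have : Tendsto (fun α : ℝ => √(Real.exp ((L + 1) * r) * (α - β) ^ 2)) (𝓝 β)
          (𝓝 √(Real.exp ((L + 1) * r) * (β - β) ^ 2)) := Continuous.tendsto (by fun_prop) β
      simpa using this.mono_left nhdsWithin_le_nhds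
    refine squeeze_zero' (.of_forall fun α => norm_nonneg _) ?_ h1
    filter_upwards [Ioo_mem_nhdsLT hβ] with α hα
    rw [Real.norm_eq_abs]
    refine Real.abs_le_sqrt ((hu α hα.1).sq_sub_le (by omega) (hu β hβ) hL.le (fun s hs => ?_) hr)
    exact hlip _ (hb α ⟨hα.1, hα.2.le⟩ s hs) _ (hb β ⟨hβ, le_rfl⟩ s hs)
  -- For a fixed test function the quadratic form is continuous from the left in `α`, by dominated
  -- convergence and continuous dependence.
  have hlim : Tendsto (fun α => ∫ x, (‖gradient φ x‖ ^ 2 - deriv f (radial N (u α) x) * φ x ^ 2))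
      (𝓝[<] β) (𝓝 (∫ x, (‖gradient φ x‖ ^ 2 - deriv f (radial N (u β) x) * φ x ^ 2))) := by
    refine tendsto_integral_filter_of_dominated_convergence
      (fun x => ‖gradient φ x‖ ^ 2 + C * φ x ^ 2) ?_ ?_ ?_ ?_
    · filter_upwards [Ioo_mem_nhdsLT hβ] with α hα
      exact (continuous_integrand hf.continuous_deriv (hu α hα.1).cont hφ).aestronglyMeasurable
    · filter_upwards [Ioo_mem_nhdsLT hβ] with α hα
      refine .of_forall fun x => (norm_sub_le _ _).trans ?_
      rw [norm_mul, norm_pow, norm_norm, norm_pow, Real.norm_eq_abs (φ x), sq_abs]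
      have := hC _ (hb α ⟨hα.1, hα.2.le⟩ ‖x‖ (norm_nonneg x))
      exact add_le_add le_rfl (mul_le_mul_of_nonneg_right this (sq_nonneg _))
    · refine Continuous.integrable_of_hasCompactSupport
        (((continuous_gradient hφ).norm.pow 2).add (continuous_const.mul (hφ.continuous.pow 2)))
        (HasCompactSupport.intro hs.isCompact fun x hx => ?_)
      simp [gradient_eq_zero_of_notMem_tsupport hx, image_eq_zero_of_notMem_tsupport hx]
    · refine .of_forall fun x => tendsto_const_nhds.sub (Tendsto.mul_const _ ?_)
      exact (hf.continuous_deriv.tendsto _).comp (hptw ‖x‖ (norm_nonneg x))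
  refine ge_of_tendsto hlim ?_
  filter_upwards [Ioo_mem_nhdsLT hβ] with α hα using hst α hα φ hφ hs

/-- The threshold is the supremum of the stable initial values. This set is downward closed,
contains small values and omits some value, so the supremum is finite and positive. -/
lemma structureIII {N : ℕ} (hN : 3 ≤ N) {f : ℝ → ℝ} (hf : IsAdmissible f) {q₀ qinf : ℝ}
    (hq₀ : Tendsto (fun u => deriv f u * tailIntegral f u) (𝓝[>] 0) (𝓝 q₀))
    (hqinf : Tendsto (fun u => deriv f u * tailIntegral f u) atTop (𝓝 qinf))
    (h1 : 1 < q₀) (h2 : q₀ < qJL N) (h3 : qJL N < qinf) {u du : ℝ → ℝ → ℝ}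
    (hu : ∀ α > 0, IsProfile N f α (u α) (du α)) : StructureIII N f u := by
  obtain ⟨α₀, hα₀, hsmall⟩ := exists_forall_le_isStable hN hf hq₀ h1 h2
  obtain ⟨α₂, hα₂, hlarge⟩ := exists_not_isStable (by omega) hf hqinf (by linarith) h3 hu
  set S : Set ℝ := {α | 0 < α ∧ IsStable f (radial N (u α))} with hS
  have hdown : ∀ α ∈ S, ∀ β > 0, β < α → β ∈ S := fun α hα β hβ hβα =>
    ⟨hβ, (hu α hα.1).isStable_of_lt (by omega) hf hα.1 hα.2 hβ hβα (hu β hβ)⟩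
  have hα₀S : α₀ ∈ S := ⟨hα₀, hsmall α₀ hα₀ le_rfl _ _ (hu α₀ hα₀)⟩
  have hbdd : BddAbove S := ⟨α₂, fun α hα => by
    by_contra! hlt
    exact hlarge (hdown α hα α₂ hα₂ hlt).2⟩
  have hpos : 0 < sSup S := hα₀.trans_le (le_csSup hbdd hα₀S)
  have hlt : ∀ α ∈ Ioo 0 (sSup S), α ∈ S := fun α hα => by
    obtain ⟨β, hβ, hαβ⟩ := exists_lt_of_lt_csSup ⟨α₀, hα₀S⟩ hα.2
    exact hdown β hβ α hα.1 hαβ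
  refine ⟨sSup S, hpos, fun α hα => ?_, fun α hα hst => ?_, fun r hr α hα β hβ hαβ => ?_⟩
  · rcases hα.2.eq_or_lt with rfl | h
    · exact isStable_of_forall_lt (by omega) hf hu hpos fun α hα => (hlt α hα).2
    · exact (hlt α ⟨hα.1, h⟩).2
  · exact absurd (le_csSup hbdd ⟨hpos.trans hα, hst⟩) (not_le.2 hα)
  · exact (hu β hβ.1).lt_of_isStable (by omega) hf hβ.1 (hlt β hβ).2 hα.1 hαβ (hu α hα.1) hr.le

end RadialStability

theorem corollary1p7 (N : ℕ) (hN : 11 ≤ N) (f : ℝ → ℝ) (hf : RadialStability.IsAdmissible f)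
    (q₀ qinf : ℝ)
    (hq₀ : Tendsto (fun u => deriv f u * RadialStability.tailIntegral f u) (𝓝[>] 0) (𝓝 q₀))
    (hqinf : Tendsto (fun u => deriv f u * RadialStability.tailIntegral f u) atTop (𝓝 qinf))
    (h1 : 1 < q₀) (h2 : q₀ < RadialStability.qJL N) (h3 : RadialStability.qJL N < qinf) :
    ∃ u : ℝ → ℝ → ℝ,
      (∀ α > 0, RadialStability.IsRadialSolution N f α (u α) ∧
        ∀ v, RadialStability.IsRadialSolution N f α v → EqOn v (u α) (Ici 0)) ∧
      RadialStability.StructureIII N f u := by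
  have hex : ∀ α : ℝ, ∃ u : ℝ → ℝ, 0 < α → RadialStability.IsRadialSolution N f α u := fun α => by
    by_cases hα : 0 < α
    · obtain ⟨u, hu⟩ := RadialStability.exists_isRadialSolution (by omega : 1 ≤ N) hf hα
      exact ⟨u, fun _ => hu⟩
    · exact ⟨0, fun h => absurd h hα⟩
  choose u hu using hex
  refine ⟨u, fun α hα => ⟨hu α hα, fun v hv => ?_⟩, ?_⟩
  · exact (hu α hα).isProfile.eqOn (by omega) hf hv.isProfile
  · exact RadialStability.structureIII (by omega) hf hq₀ hqinf h1 h2 h3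
      fun α hα => (hu α hα).isProfile
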